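/- Let $A<B$ and $A_0\in[A,B]$. Let $p,q,w:[A,B]\to\mathbb{R}$ be such that $p,p',q,w,w'$ are continuous, $p'$ and $w'$ are absolutely continuous, and $p>0$, $w>0$ on $[A,B]$. Put $$\mathbf{C}u=\frac1w\bigl((pu')'-qu\bigr),\qquad \rho=(pw)^{1/4},\qquad l(y)=\int_{A_0}^{y}\Bigl(\frac{w(s)}{p(s)}\Bigr)^{1/2}ds,\qquad b=\max\{-l(A),\,l(B)\}.$$ (If $A_0$ is chosen so that $l(A)=-l(B)$, then $b=l(B)=-l(A)$; if $A_0=A$, then $b=l(B)$.) Let $f:[A,B]\to\mathbb{C}$ be a non-vanishing solution of $(pf')'-qf=0$ on $[A,B]$ with $f(A_0)=1/\rho(A_0)$. The formal powers associated with $f$ are $\Phi_k=fY^{(k)}$ for odd $k$ and $\Phi_k=f\tilde Y^{(k)}$ for even $k$, where $Y^{(0)}\equiv\tilde Y^{(0)}\equiv1$ and, for $k\ge1$, $$Y^{(k)}(y)=\begin{cases}k\int_{A_0}^{y}Y^{(k-1)}(s)\,\dfrac{ds}{f^2(s)p(s)},&k\text{ odd},\\[2mm] k\int_{A_0}^{y}Y^{(k-1)}(s)f^2(s)w(s)\,ds,&k\text{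 even},\end{cases}\qquad \tilde Y^{(k)}(y)=\begin{cases}k\int_{A_0}^{y}\tilde Y^{(k-1)}(s)f^2(s)w(s)\,ds,&k\text{ odd},\\[2mm] k\int_{A_0}^{y}\tilde Y^{(k-1)}(s)\,\dfrac{ds}{f^2(s)p(s)},&k\text{ even}.\end{cases}$$ There is a unique continuous complex-valued function $K$ on $\{(y,t):y\in[A,B],\ |t|\le|l(y)|\}$ such that the operator $$\mathbf{T}h(y)=\frac{h(l(y))}{\rho(y)}+\int_{-l(y)}^{l(y)}K(y,t)h(t)\,dt,\qquad y\in[A,B],\quad h\in C[-b,b],$$ maps $C^2[-b,b]$ into $C^2[A,B]$, satisfies $\mathbf{C}\mathbf{T}h=\mathbf{T}h''$ for all $h\in C^2[-b,b]$, and satisfies $\mathbf{T}[1]=f$. For $n=0,1,2,\dots$ let $$h_n(x,t)=\sum_{k=0}^{[n/2]}c_k^n\,x^{n-2k}t^k,\qquad c_k^n=\frac{n!}{(n-2k)!\,k!},$$ be the heat polynomials, and let $H_n(\cdot,t)=\mathbf{T}[h_n(\cdot,t)]$ be the transmuted heat polynomials. Then, for all $n\ge0$, $y\in[A,B]$ and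 $t\in\mathbb{R}$, $$H_n(y,t)=\sum_{k=0}^{[n/2]}c_k^n\,\Phi_{n-2k}(y)\,t^k.$$ -/

import Mathlib

open Set

noncomputable section

namespace TransmutedHeat

/-- The standing assumption on the coefficients of
`C u = (1 / w) * ((p * u')' - q * u)` on the segment `[A, B]`: the functions `p`, `p'`, `q`, `w`,
`w'` are continuous, `p'` and `w'` are absolutely continuous, and `p`, `w` are positive. -/
structure IsAdmissible (p q w : ℝ → ℝ) (A B : ℝ) : Prop where
  contDiffOn_p : ContDiffOn ℝ 1 p (Icc A B)
  contDiffOn_w : ContDiffOn ℝ 1 w (Icc A B)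
  continuousOn_q : ContinuousOn q (Icc A B)
  absCont_deriv_p : AbsolutelyContinuousOnInterval (derivWithin p (Icc A B)) A B
  absCont_deriv_w : AbsolutelyContinuousOnInterval (derivWithin w (Icc A B)) A B
  p_pos : ∀ y ∈ Icc A B, 0 < p y
  w_pos : ∀ y ∈ Icc A B, 0 < w y

/-- `ρ y = (p y * w y) ^ (1 / 4)`. -/
def rho (p w : ℝ → ℝ) (y : ℝ) : ℝ := (p y * w y) ^ (1 / 4 : ℝ)

/-- The Liouville change of variable `l y = ∫_{A₀}^y (w / p)^{1/2}`. -/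
def liouville (p w : ℝ → ℝ) (A₀ y : ℝ) : ℝ := ∫ s in A₀..y, Real.sqrt (w s / p s)

/-- The half-length `b` of the symmetric segment `[-b, b]` on which the operator `T` takes its
arguments: the smallest one that contains `l ([A, B])`. If `A₀` is the `l`-midpoint of `[A, B]`,
then `b = -l A = l B`; if `A₀ = A`, then `b = l B`. -/
def halfLength (p w : ℝ → ℝ) (A B A₀ : ℝ) : ℝ :=
  max (-liouville p w A₀ A) (liouville p w A₀ B)

/-- The operator `C u = (1 / w) * ((p * u')' - q * u)` on the segment `[A, B]`
(one-sided derivatives at the end points). -/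
def opC (p q w : ℝ → ℝ) (A B : ℝ) (u : ℝ → ℂ) (y : ℝ) : ℂ :=
  1 / (w y : ℂ) *
    (derivWithin (fun z => (p z : ℂ) * derivWithin u (Icc A B) z) (Icc A B) y - (q y : ℂ) * u y)

/-- `f` is a (classical, complex-valued) solution of `(p * f')' - q * f = 0` on `[A, B]`. -/
structure IsSolution (p q : ℝ → ℝ) (A B : ℝ) (f : ℝ → ℂ) : Prop where
  differentiableOn : DifferentiableOn ℝ f (Icc A B)
  differentiableOn_mul_deriv :
    DifferentiableOn ℝ (fun z => (p z : ℂ) * derivWithin f (Icc A B) z) (Icc A B)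
  eq_zero : ∀ y ∈ Icc A B,
    derivWithin (fun z => (p z : ℂ) * derivWithin f (Icc A B) z) (Icc A B) y
      - (q y : ℂ) * f y = 0

/-- The auxiliary functions `Y^(k)`: `Y^(0) = 1`, and `Y^(k)` is `k` times the integral from `A₀`
of `Y^(k-1) / (f² p)` for odd `k` and of `Y^(k-1) f² w` for even `k`. -/
def Y (p w : ℝ → ℝ) (f : ℝ → ℂ) (A₀ : ℝ) : ℕ → ℝ → ℂ
  | 0 => fun _ => 1
  | k + 1 => fun y =>
      if Odd (k + 1) then
        ((k + 1 : ℕ) : ℂ) * ∫ s in A₀..y, Y p w f A₀ k s * (1 / (f s ^ 2 * (p s : ℂ)))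
      else
        ((k + 1 : ℕ) : ℂ) * ∫ s in A₀..y, Y p w f A₀ k s * (f s ^ 2 * (w s : ℂ))

/-- The auxiliary functions `Ỹ^(k)`: `Ỹ^(0) = 1`, and `Ỹ^(k)` is `k` times the integral from `A₀`
of `Ỹ^(k-1) f² w` for odd `k` and of `Ỹ^(k-1) / (f² p)` for even `k`. -/
def Ytilde (p w : ℝ → ℝ) (f : ℝ → ℂ) (A₀ : ℝ) : ℕ → ℝ → ℂ
  | 0 => fun _ => 1
  | k + 1 => fun y =>
      if Odd (k + 1) then
        ((k + 1 : ℕ) : ℂ) * ∫ s in A₀..y, Ytilde p w f A₀ k s * (f s ^ 2 * (w s : ℂ))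
      else
        ((k + 1 : ℕ) : ℂ) * ∫ s in A₀..y, Ytilde p w f A₀ k s * (1 / (f s ^ 2 * (p s : ℂ)))

/-- The formal powers `Φ_k`: `f * Y^(k)` for odd `k` and `f * Ỹ^(k)` for even `k`. -/
def Phi (p w : ℝ → ℝ) (f : ℝ → ℂ) (A₀ : ℝ) (k : ℕ) (y : ℝ) : ℂ :=
  if Odd k then f y * Y p w f A₀ k y else f y * Ytilde p w f A₀ k y

/-- The operator with kernel `K`:
`T h (y) = h (l y) / ρ y + ∫_{-l y}^{l y} K (y, t) h (t) dt`. -/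
def opT (p w : ℝ → ℝ) (A₀ : ℝ) (K : ℝ → ℝ → ℂ) (h : ℝ → ℂ) (y : ℝ) : ℂ :=
  h (liouville p w A₀ y) / (rho p w y : ℂ)
    + ∫ t in (-liouville p w A₀ y)..(liouville p w A₀ y), K y t * h t

/-- The domain `{(y, t) : y ∈ [A, B], |t| ≤ |l y|}` of a kernel. -/
def kernelDomain (p w : ℝ → ℝ) (A B A₀ : ℝ) : Set (ℝ × ℝ) :=
  {z | z.1 ∈ Icc A B ∧ |z.2| ≤ |liouville p w A₀ z.1|}

/-- The defining properties of the kernel `K` of the transmutation operator `T` for the pair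
`C`, `∂ₓₓ` that is associated with `f`: `K` is continuous on its domain, `T` maps `C²[-b, b]` into
`C²[A, B]`, `C T h = T h''` for every `h ∈ C²[-b, b]`, and `T 1 = f`. -/
structure IsTransmutationKernel (p q w : ℝ → ℝ) (A B A₀ : ℝ) (f : ℝ → ℂ) (K : ℝ → ℝ → ℂ) :
    Prop where
  continuousOn : ContinuousOn (fun z : ℝ × ℝ => K z.1 z.2) (kernelDomain p w A B A₀)
  mapsTo : ∀ h : ℝ → ℂ,
    ContDiffOn ℝ 2 h (Icc (-halfLength p w A B A₀) (halfLength p w A B A₀)) →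
      ContDiffOn ℝ 2 (opT p w A₀ K h) (Icc A B)
  intertwines : ∀ h : ℝ → ℂ,
    ContDiffOn ℝ 2 h (Icc (-halfLength p w A B A₀) (halfLength p w A B A₀)) →
      ∀ y ∈ Icc A B,
        opC p q w A B (opT p w A₀ K h) y =
          opT p w A₀ K
            (derivWithin
              (derivWithin h (Icc (-halfLength p w A B A₀) (halfLength p w A B A₀)))
              (Icc (-halfLength p w A B A₀) (halfLength p w A B A₀))) y
  map_one : ∀ y ∈ Icc A B, opT p w A₀ K (fun _ => 1) y = f y

/-- `c_k^n = n! / ((n - 2k)! k!)`, for `2k ≤ n`. -/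
def coeff (n k : ℕ) : ℂ :=
  (n.factorial : ℂ) / (((n - 2 * k).factorial : ℂ) * (k.factorial : ℂ))

/-- The heat polynomial `h_n (x, t)`. -/
def heatPoly (n : ℕ) (x t : ℝ) : ℂ :=
  ∑ k ∈ Finset.range (n / 2 + 1), coeff n k * (x : ℂ) ^ (n - 2 * k) * (t : ℂ) ^ k

/-- The transmuted heat polynomial `H_n (y, t) = T [h_n (·, t)] (y)`. -/
def transmutedHeatPoly (p w : ℝ → ℝ) (A₀ : ℝ) (K : ℝ → ℝ → ℂ) (n : ℕ) (y t : ℝ) : ℂ :=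
  opT p w A₀ K (fun x => heatPoly n x t) y

end TransmutedHeat

end

/-!
In the Liouville variable `x = l y`, and with `v = ρ u`, the operator `C` becomes
`v ↦ (∂ + θ) (∂ - θ) v`, where `θ` is the logarithmic derivative of `ρ f`. This `θ` is merely
continuous, and the potential `θ' + θ ^ 2` never has to be written down: the normalised operator,
`T` multiplied by `ρ` and still called `T` here, is constructed together with a partner `S` for
`(∂ - θ) (∂ + θ)`, by the first-order relations `(∂ - θ) T h = S h'` and `(∂ + θ) S h = T h'`. In
characteristic coordinates `u = (x + t) / 2`, `v = (x - t) / 2` the sum `P` and the difference `M`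
of the two kernels solve the Goursat problem `∂ᵤ P = θ (u + v) M`, `∂ᵥ M = θ (u + v) P`,
`P (0, v) = 0`, `M (u, 0) = θ u`, which the contraction principle solves on the whole plane
(`exists_goursat`), so that both signs of `x` are covered at once. Leibniz' rule gives the
first-order relations (`exists_normalized_kernels`), and these, read in the variable `y`, are the
intertwining relation (`hasDerivWithinAt_of_system`, `exists_isTransmutationKernel`). The image of
`1` has the same logarithmic derivative `θ` and the same value at `A₀` as `ρ f`, whence the
normalisation.

Conversely, let `K` be any transmutation kernel. For `n ≥ 1`, `u = T [x ^ n]` satisfies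
`C u = n (n - 1) T [x ^ (n - 2)]`, and its Cauchy data at `A₀` are those of `l ^ n / ρ`, because
the integral term is `O (l ^ (n + 1))`. Reduction of order by `f` (`eq_integral_of_opC_eq`) solves
this problem by two quadratures, which are those in the recursion of the formal powers, so that
`T [x ^ n] = Φ_n` (`IsTransmutationKernel.opT_pow`). By linearity, the formula for the transmuted
heat polynomials follows. It also follows that all kernels have the same moments on each slice
`y = const`, and Weierstrass' theorem gives uniqueness (`IsTransmutationKernel.unique`).
-/

namespace TransmutedHeat

open Filter Topology intervalIntegral Asymptotics

/-! ### The Goursat problem -/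

/-- Integration from `0` gains a factor `1 / r` in the norm with weight `exp (r * |a|)`. -/
theorem norm_integral_le_exp {F : ℝ → ℂ} {c r : ℝ} (hr : 0 < r)
    (hF : ∀ a, ‖F a‖ ≤ c * Real.exp (r * |a|)) (u : ℝ) :
    ‖∫ a in (0 : ℝ)..u, F a‖ ≤ c * Real.exp (r * |u|) / r := by
  have hc : 0 ≤ c := by simpa using (norm_nonneg _).trans (hF 0)
  have key : ∀ {G : ℝ → ℂ}, (∀ a, ‖G a‖ ≤ c * Real.exp (r * |a|)) → ∀ v : ℝ, 0 ≤ v →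
      ‖∫ a in (0 : ℝ)..v, G a‖ ≤ c * Real.exp (r * v) / r := by
    intro G hG v hv
    have h1 : ‖∫ a in (0 : ℝ)..v, G a‖ ≤ ∫ a in (0 : ℝ)..v, c * Real.exp (r * a) := by
      refine norm_integral_le_of_norm_le hv (.of_forall fun a ha => ?_)
        (Continuous.intervalIntegrable (by fun_prop) _ _)
      simpa [abs_of_pos ha.1] using hG a
    have h2 : ∫ a in (0 : ℝ)..v, c * Real.exp (r * a) = c * (Real.exp (r * v) - 1) / r := by
      rw [intervalIntegral.integral_const_mul,
        intervalIntegral.integral_comp_mul_left (fun a => Real.exp a) hr.ne', integral_exp]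
      simp only [mul_zero, Real.exp_zero, smul_eq_mul]
      field_simp
    rw [h2] at h1
    refine h1.trans ?_
    gcongr
    linarith
  rcases le_total 0 u with hu | hu
  · simpa [abs_of_nonneg hu] using key hF u hu
  · have := key (G := fun a => F (-a)) (fun a => by simpa using hF (-a)) (-u) (by linarith)
    rw [intervalIntegral.integral_comp_neg (fun a => F a)] at this
    rw [abs_of_nonpos hu, integral_symm, norm_neg]
    simpa using this

/-- The Volterra operator `m ↦ ∫_0^u θ (a + v) m (a, v) da`, conjugated with the weight
`exp (r * (|u| + |v|))` that turns it into a contraction for large `r`. -/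
noncomputable def weightedVolterra (θ : ℝ → ℂ) (hθ : Continuous θ) (C r : ℝ) (hr : 0 < r)
    (hC : ∀ x, ‖θ x‖ ≤ C) (m : BoundedContinuousFunction (ℝ × ℝ) ℂ) :
    BoundedContinuousFunction (ℝ × ℝ) ℂ :=
  BoundedContinuousFunction.ofNormedAddCommGroup
    (fun z => (Real.exp (-(r * (|z.1| + |z.2|))) : ℂ) *
      ∫ a in (0 : ℝ)..z.1, θ (a + z.2) * ((Real.exp (r * (|a| + |z.2|)) : ℂ) * m (a, z.2)))
    (by
      refine Continuous.mul (by fun_prop) ?_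
      refine continuous_parametric_intervalIntegral_of_continuous
        (f := fun z : ℝ × ℝ => fun a : ℝ =>
          θ (a + z.2) * ((Real.exp (r * (|a| + |z.2|)) : ℂ) * m (a, z.2))) ?_ continuous_fst
      simp only [Function.uncurry_def]
      fun_prop)
    (C * ‖m‖ / r)
    (fun z => by
      have h := norm_integral_le_exp (c := C * ‖m‖ * Real.exp (r * |z.2|)) hr
        (F := fun a => θ (a + z.2) * ((Real.exp (r * (|a| + |z.2|)) : ℂ) * m (a, z.2)))
        (fun a => by
          rw [norm_mul, norm_mul, Complex.norm_real, Real.norm_eq_abs, Real.abs_exp]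
          calc ‖θ (a + z.2)‖ * (Real.exp (r * (|a| + |z.2|)) * ‖m (a, z.2)‖)
              ≤ C * (Real.exp (r * (|a| + |z.2|)) * ‖m‖) := by
                gcongr
                · exact (norm_nonneg _).trans (hC 0)
                · exact hC _
                · exact m.norm_coe_le_norm _
            _ = C * ‖m‖ * Real.exp (r * |z.2|) * Real.exp (r * |a|) := by
                rw [mul_add, Real.exp_add]; ring) z.1
      rw [norm_mul, Complex.norm_real, Real.norm_eq_abs, Real.abs_exp]
      calc _ ≤ Real.exp (-(r * (|z.1| + |z.2|))) *
            (C * ‖m‖ * Real.exp (r * |z.2|) * Real.exp (r * |z.1|) / r) := by gcongr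
        _ = C * ‖m‖ / r * Real.exp (-(r * (|z.1| + |z.2|)) + (r * |z.2| + r * |z.1|)) := by
            rw [Real.exp_add, Real.exp_add (r * |z.2|)]; ring
        _ = C * ‖m‖ / r := by
            rw [show -(r * (|z.1| + |z.2|)) + (r * |z.2| + r * |z.1|) = 0 by ring]; simp)

section

variable {θ : ℝ → ℂ} (hθ : Continuous θ) {C r : ℝ} (hr : 0 < r) (hC : ∀ x, ‖θ x‖ ≤ C)

theorem norm_weightedVolterra_le (m : BoundedContinuousFunction (ℝ × ℝ) ℂ) :
    ‖weightedVolterra θ hθ C r hr hC m‖ ≤ C * ‖m‖ / r := by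
  have hC0 : 0 ≤ C := (norm_nonneg _).trans (hC 0)
  exact BoundedContinuousFunction.norm_ofNormedAddCommGroup_le _ (by positivity) _

theorem weightedVolterra_sub (m m' : BoundedContinuousFunction (ℝ × ℝ) ℂ) :
    weightedVolterra θ hθ C r hr hC (m - m') =
      weightedVolterra θ hθ C r hr hC m - weightedVolterra θ hθ C r hr hC m' := by
  ext z
  simp only [weightedVolterra, BoundedContinuousFunction.coe_ofNormedAddCommGroup,
    BoundedContinuousFunction.coe_sub, Pi.sub_apply]
  rw [← mul_sub, ← intervalIntegral.integral_sub]
  · simp only [mul_sub]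
  all_goals exact Continuous.intervalIntegrable (by fun_prop) _ _

end

/-- The Goursat problem `∂ᵤ P = θ (u + v) M`, `∂ᵥ M = θ (u + v) P`, `P (0, v) = 0`,
`M (u, 0) = θ u`, in integral form. -/
theorem exists_goursat {θ : ℝ → ℂ} (hθ : Continuous θ) {C : ℝ} (hC : ∀ x, ‖θ x‖ ≤ C) :
    ∃ P M : ℝ × ℝ → ℂ, Continuous P ∧ Continuous M ∧
      (∀ u v, P (u, v) = ∫ a in (0 : ℝ)..u, θ (a + v) * M (a, v)) ∧
      (∀ u v, M (u, v) = θ u + ∫ c in (0 : ℝ)..v, θ (u + c) * P (u, c)) := by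
  have hC0 : 0 ≤ C := (norm_nonneg _).trans (hC 0)
  -- a weight so heavy that the Volterra operator has norm at most `1 / 2`
  obtain ⟨r, hr, hCr⟩ : ∃ r : ℝ, 0 < r ∧ C / r ≤ 1 / 2 :=
    ⟨2 * C + 1, by linarith, by rw [div_le_div_iff₀ (by linarith) (by norm_num)]; linarith⟩
  set J := weightedVolterra θ hθ C r hr hC with hJ
  have hJn : ∀ m, ‖J m‖ ≤ 1 / 2 * ‖m‖ := fun m =>
    (norm_weightedVolterra_le hθ hr hC m).trans (by rw [mul_div_right_comm]; gcongr)
  -- the equation for `M` is the one for `P` with the two variables swapped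
  let s : C(ℝ × ℝ, ℝ × ℝ) := ⟨Prod.swap, continuous_swap⟩
  let sw : BoundedContinuousFunction (ℝ × ℝ) ℂ → BoundedContinuousFunction (ℝ × ℝ) ℂ :=
    fun m => m.compContinuous s
  have hsw : ∀ m, ‖sw m‖ ≤ ‖m‖ := fun m =>
    (BoundedContinuousFunction.norm_le (norm_nonneg _)).2 fun z => m.norm_coe_le_norm _
  let m₀ : BoundedContinuousFunction (ℝ × ℝ) ℂ :=
    BoundedContinuousFunction.ofNormedAddCommGroup
      (fun z => (Real.exp (-(r * (|z.1| + |z.2|))) : ℂ) * θ z.1) (by fun_prop) C (fun z => by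
        rw [norm_mul, Complex.norm_real, Real.norm_eq_abs, Real.abs_exp]
        calc _ ≤ 1 * C := by
              gcongr
              · rw [Real.exp_le_one_iff]
                have : 0 ≤ r * (|z.1| + |z.2|) := by positivity
                linarith
              · exact hC _
          _ = C := one_mul _)
  have hct : ContractingWith (1 / 2) fun m => m₀ + sw (J (sw (J m))) := by
    refine ⟨by rw [← NNReal.coe_lt_coe]; norm_num, LipschitzWith.of_dist_le_mul fun m m' => ?_⟩
    rw [dist_eq_norm, dist_eq_norm]
    have hs : ∀ m m', sw (m - m') = sw m - sw m' := fun m m' => by ext z; rfl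
    have : m₀ + sw (J (sw (J m))) - (m₀ + sw (J (sw (J m')))) = sw (J (sw (J (m - m')))) := by
      simp only [hJ, weightedVolterra_sub, hs]; abel
    rw [this]
    have h1 := hsw (J (sw (J (m - m'))))
    have h2 := hJn (sw (J (m - m')))
    have h3 := hsw (J (m - m'))
    have h4 := hJn (m - m')
    have h5 := norm_nonneg (m - m')
    push_cast
    linarith
  set m := ContractingWith.fixedPoint _ hct with hm
  have hfix : m₀ + sw (J (sw (J m))) = m := hct.fixedPoint_isFixedPt
  have hexp : ∀ t : ℝ, (Real.exp t : ℂ) * (Real.exp (-t) : ℂ) = 1 := fun t => by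
    rw [← Complex.ofReal_mul, ← Real.exp_add]; simp
  refine ⟨fun z => (Real.exp (r * (|z.1| + |z.2|)) : ℂ) * J m z,
    fun z => (Real.exp (r * (|z.1| + |z.2|)) : ℂ) * m z, by fun_prop, by fun_prop, ?_, ?_⟩
  · intro u v
    change _ * ((Real.exp (-(r * (|u| + |v|))) : ℂ) * _) = _
    rw [← mul_assoc, hexp, one_mul]
  · intro u v
    conv_lhs => rw [← hfix]
    change _ * ((Real.exp (-(r * (|u| + |v|))) : ℂ) * θ u +
      (Real.exp (-(r * (|v| + |u|))) : ℂ) * _) = _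
    rw [mul_add, add_comm |v|, ← mul_assoc, ← mul_assoc, hexp, one_mul, one_mul]
    congr 1
    refine intervalIntegral.integral_congr fun c _ => ?_
    change θ (c + u) * ((Real.exp (r * (|c| + |u|)) : ℂ) * J m (u, c)) = _
    dsimp only
    rw [add_comm c, add_comm |c|]

/-- Leibniz' rule for an integral with a parameter in the integrand and in the upper limit. -/
theorem hasDerivAt_integral_diag {F F' : ℝ → ℝ → ℂ} (hF : Continuous fun z : ℝ × ℝ => F z.1 z.2)
    (hF' : Continuous fun z : ℝ × ℝ => F' z.1 z.2)
    (h : ∀ x s, HasDerivAt (fun x => F x s) (F' x s) x) (x : ℝ) :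
    HasDerivAt (fun x => ∫ s in (0 : ℝ)..x, F x s) (F x x + ∫ s in (0 : ℝ)..x, F' x s) x := by
  have hc : ∀ x, Continuous (F x) := fun x => hF.comp (by fun_prop : Continuous fun s => (x, s))
  have hc' : ∀ x, Continuous (F' x) := fun x => hF'.comp (by fun_prop : Continuous fun s => (x, s))
  have hpar : ∀ y a : ℝ, HasDerivAt (fun x => ∫ s in (0 : ℝ)..a, F x s)
      (∫ s in (0 : ℝ)..a, F' y s) y := by
    intro y a
    obtain ⟨c, hbd⟩ := ((isCompact_closedBall y 1).prod (isCompact_uIcc (a := (0 : ℝ))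
      (b := a))).exists_bound_of_continuousOn hF'.continuousOn
    refine (hasDerivAt_integral_of_dominated_loc_of_deriv_le (bound := fun _ => c)
      (Metric.closedBall_mem_nhds y one_pos) (.of_forall fun x => (hc x).aestronglyMeasurable)
      ((hc y).intervalIntegrable _ _) (hc' y).aestronglyMeasurable
      (.of_forall fun s hs x hx => hbd (x, s) ⟨hx, uIoc_subset_uIcc hs⟩)
      intervalIntegrable_const (.of_forall fun s _ x _ => h x s)).2
  have hs := hasStrictFDerivAt_uncurry_coprod (𝕜 := ℝ) (u := (x, x))
    (f := fun y a : ℝ => ∫ s in (0 : ℝ)..a, F y s)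
    (f₁ := fun y a => ContinuousLinearMap.toSpanSingleton ℝ (∫ s in (0 : ℝ)..a, F' y s))
    (f₂ := fun y a => ContinuousLinearMap.toSpanSingleton ℝ (F y a))
    (.of_forall fun z => (hpar z.1 z.2).hasFDerivAt)
    (.of_forall fun z => ((hc z.1).integral_hasStrictDerivAt 0 z.2).hasDerivAt.hasFDerivAt)
    ?_ ?_
  · have := hs.hasFDerivAt.comp_hasDerivAt (f := fun x => (x, x)) x
      ((hasDerivAt_id x).prodMk (hasDerivAt_id x))
    refine this.congr_deriv ?_
    simp [Function.HasUncurry.uncurry, add_comm]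
  · refine Continuous.continuousAt ?_
    refine (ContinuousLinearMap.toSpanSingletonCLE (𝕜 := ℝ) (E := ℂ)).continuous.comp ?_
    exact continuous_parametric_primitive_of_continuous (f := fun y s => F' y s) hF'
  · refine Continuous.continuousAt ?_
    exact (ContinuousLinearMap.toSpanSingletonCLE (𝕜 := ℝ) (E := ℂ)).continuous.comp hF

/-! ### The normalised transmutation operators -/

/-- The operator `h ↦ h (x) + ∫_{-x}^x k (x, t) h (t) dt`: this is `T` in the Liouville variable
`x = l y`, after multiplication by `ρ`. -/
noncomputable def normT (k : ℝ → ℝ → ℂ) (h : ℝ → ℂ) (x : ℝ) : ℂ :=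
  h x + ∫ t in (-x)..x, k x t * h t

/-- The substitution `t = 2 u - x`, that is `(u, x - u) = ((x + t) / 2, (x - t) / 2)`. -/
theorem integral_characteristic (G : ℝ × ℝ → ℂ) (h : ℝ → ℂ) (x : ℝ) :
    ∫ u in (0 : ℝ)..x, G (u, x - u) * h (2 * u - x) =
      ∫ t in (-x)..x, 1 / 2 * G ((x + t) / 2, (x - t) / 2) * h t := by
  have := integral_comp_mul_sub (a := 0) (b := x)
    (fun t => G ((x + t) / 2, (x - t) / 2) * h t) (two_ne_zero (α := ℝ)) x
  have e : ∀ u : ℝ, (x + (2 * u - x)) / 2 = u ∧ (x - (2 * u - x)) / 2 = x - u := fun u =>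
    ⟨by ring, by ring⟩
  simp only [e] at this
  rw [this, show 2 * 0 - x = -x by ring, show 2 * x - x = x by ring, Complex.real_smul,
    ← intervalIntegral.integral_const_mul]
  refine integral_congr fun t _ => ?_
  push_cast
  ring

/-- The two kernels of the normalised transmutation operators for
`(∂ + θ) (∂ - θ)` and `(∂ - θ) (∂ + θ)`; the operators are intertwined with `∂` by
`(∂ - θ) T h = S h'` and `(∂ + θ) S h = T h'`. -/
theorem exists_normalized_kernels {θ : ℝ → ℂ} (hθ : Continuous θ) {C : ℝ} (hC : ∀ x, ‖θ x‖ ≤ C) :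
    ∃ k k' : ℝ → ℝ → ℂ, Continuous (fun z : ℝ × ℝ => k z.1 z.2) ∧
      Continuous (fun z : ℝ × ℝ => k' z.1 z.2) ∧
      ∀ h h' : ℝ → ℂ, Continuous h' → (∀ x, HasDerivAt h (h' x) x) → ∀ x,
        HasDerivAt (normT k h) (θ x * normT k h x + normT k' h' x) x ∧
        HasDerivAt (normT k' h) (-(θ x * normT k' h x) + normT k h' x) x := by
  obtain ⟨P, M, hP, hM, hPe, hMe⟩ := exists_goursat hθ hC
  have hPd : ∀ u v, HasDerivAt (fun u => P (u, v)) (θ (u + v) * M (u, v)) u := by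
    intro u v
    simp only [hPe _ v]
    exact (Continuous.integral_hasStrictDerivAt (f := fun a => θ (a + v) * M (a, v))
      (by fun_prop) 0 u).hasDerivAt
  have hMd : ∀ u v, HasDerivAt (fun v => M (u, v)) (θ (u + v) * P (u, v)) v := by
    intro u v
    simp only [hMe u _]
    exact ((Continuous.integral_hasStrictDerivAt (f := fun c => θ (u + c) * P (u, c))
      (by fun_prop) 0 v).hasDerivAt).const_add _
  have hP0 : ∀ v, P (0, v) = 0 := fun v => by simp [hPe]
  have hM0 : ∀ u, M (u, 0) = θ u := fun u => by simp [hMe]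
  -- integral parts of the half-sum and of the half-difference of the two operators
  let IP : (ℝ → ℂ) → ℝ → ℂ := fun h x => ∫ u in (0 : ℝ)..x, P (u, x - u) * h (2 * u - x)
  let IM : (ℝ → ℂ) → ℝ → ℂ := fun h x => ∫ u in (0 : ℝ)..x, M (u, x - u) * h (2 * u - x)
  have hIP : ∀ h h' : ℝ → ℂ, Continuous h' → (∀ x, HasDerivAt h (h' x) x) → ∀ x,
      HasDerivAt (IP h) (θ x * IM h x + IP h' x) x := by
    intro h h' hh' hd x
    have hh : Continuous h := continuous_iff_continuousAt.2 fun x => (hd x).continuousAt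
    -- the reflection `u = x - c` moves the derivative of the kernel to its first argument
    have refl : ∀ (G : ℝ × ℝ → ℂ) (h : ℝ → ℂ) (x : ℝ),
        ∫ u in (0 : ℝ)..x, G (u, x - u) * h (2 * u - x) =
          ∫ c in (0 : ℝ)..x, G (x - c, c) * h (x - 2 * c) := by
      intro G h x
      have := integral_comp_sub_left (a := 0) (b := x)
        (fun u => G (u, x - u) * h (2 * u - x)) x
      rw [sub_self, sub_zero] at this
      rw [← this]
      refine integral_congr fun c _ => ?_
      simp only [sub_sub_cancel]
      ring_nf
    have key := hasDerivAt_integral_diag (F := fun x c => P (x - c, c) * h (x - 2 * c))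
      (F' := fun x c => θ x * M (x - c, c) * h (x - 2 * c) + P (x - c, c) * h' (x - 2 * c))
      (by fun_prop) (by fun_prop) (fun x c => by
        have h1 := (hPd (x - c) c).comp_sub_const x c
        have h2 := (hd (x - 2 * c)).comp_sub_const x (2 * c)
        have := h1.mul h2
        rwa [sub_add_cancel] at this) x
    have e : IP h = fun x => ∫ c in (0 : ℝ)..x, P (x - c, c) * h (x - 2 * c) :=
      funext fun x => refl P h x
    rw [e]
    refine key.congr_deriv ?_
    rw [intervalIntegral.integral_add (Continuous.intervalIntegrable (by fun_prop) _ _)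
      (Continuous.intervalIntegrable (by fun_prop) _ _)]
    simp only [IP, IM, refl, sub_self, hP0, zero_mul, zero_add, mul_assoc,
      intervalIntegral.integral_const_mul]
  have hIM : ∀ h h' : ℝ → ℂ, Continuous h' → (∀ x, HasDerivAt h (h' x) x) → ∀ x,
      HasDerivAt (IM h) (θ x * h x + θ x * IP h x - IM h' x) x := by
    intro h h' hh' hd x
    have hh : Continuous h := continuous_iff_continuousAt.2 fun x => (hd x).continuousAt
    have key := hasDerivAt_integral_diag (F := fun x u => M (u, x - u) * h (2 * u - x))
      (F' := fun x u => θ x * P (u, x - u) * h (2 * u - x) + M (u, x - u) * (-h' (2 * u - x)))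
      (by fun_prop) (by fun_prop) (fun x u => by
        have h1 := (hMd u (x - u)).comp_sub_const x u
        have h2 := (hd (2 * u - x)).comp_const_sub (2 * u) x
        have := h1.mul h2
        rwa [add_sub_cancel] at this) x
    refine key.congr_deriv ?_
    rw [intervalIntegral.integral_add (Continuous.intervalIntegrable (by fun_prop) _ _)
      (Continuous.intervalIntegrable (by fun_prop) _ _)]
    simp only [IP, IM, sub_self, hM0, mul_assoc, mul_neg, intervalIntegral.integral_neg,
      intervalIntegral.integral_const_mul]
    rw [show 2 * x - x = x by ring]
    ring
  have hT : ∀ h, Continuous h → ∀ x,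
      normT (fun x t => 1 / 2 * (P + M) ((x + t) / 2, (x - t) / 2)) h x = h x + IP h x + IM h x := by
    intro h hh x
    rw [normT, ← integral_characteristic, add_assoc, ← intervalIntegral.integral_add
      (Continuous.intervalIntegrable (by fun_prop) _ _)
      (Continuous.intervalIntegrable (by fun_prop) _ _)]
    simp only [Pi.add_apply, add_mul]
  have hS : ∀ h, Continuous h → ∀ x,
      normT (fun x t => 1 / 2 * (P - M) ((x + t) / 2, (x - t) / 2)) h x = h x + IP h x - IM h x := by
    intro h hh x
    rw [normT, ← integral_characteristic, add_sub_assoc, ← intervalIntegral.integral_sub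
      (Continuous.intervalIntegrable (by fun_prop) _ _)
      (Continuous.intervalIntegrable (by fun_prop) _ _)]
    simp only [Pi.sub_apply, sub_mul]
  refine ⟨fun x t => 1 / 2 * (P + M) ((x + t) / 2, (x - t) / 2),
    fun x t => 1 / 2 * (P - M) ((x + t) / 2, (x - t) / 2), ?_, ?_, fun h h' hh' hd x => ?_⟩
  rotate_left 2
  · have hh : Continuous h := continuous_iff_continuousAt.2 fun x => (hd x).continuousAt
    rw [funext (hT h hh), funext (hS h hh), hT h' hh', hS h' hh']
    refine ⟨(((hd x).add (hIP h h' hh' hd x)).add (hIM h h' hh' hd x)).congr_deriv (by ring),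
      (((hd x).add (hIP h h' hh' hd x)).sub (hIM h h' hh' hd x)).congr_deriv (by ring)⟩
  · simp only [Pi.add_apply]; fun_prop
  · simp only [Pi.sub_apply]; fun_prop

/-! ### Calculus on a segment -/

section Interval

variable {A B : ℝ} {E : Type*} [NormedAddCommGroup E] [NormedSpace ℝ E]

theorem hasDerivWithinAt_primitive [CompleteSpace E] {c : ℝ} (hc : c ∈ Icc A B) {g : ℝ → E}
    (hg : ContinuousOn g (Icc A B)) {y : ℝ} (hy : y ∈ Icc A B) :
    HasDerivWithinAt (fun y => ∫ s in c..y, g s) (g y) (Icc A B) y := by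
  have hAB : A ≤ B := hc.1.trans hc.2
  have hG : Continuous (IccExtend hAB ((Icc A B).domRestrict g)) :=
    (continuousOn_iff_continuous_domRestrict.1 hg).Icc_extend'
  have hGe : EqOn (IccExtend hAB ((Icc A B).domRestrict g)) g (Icc A B) := fun x hx => by
    rw [IccExtend_of_mem _ _ hx]; rfl
  have h := (hG.integral_hasStrictDerivAt c y).hasDerivAt.hasDerivWithinAt (s := Icc A B)
  rw [hGe hy] at h
  refine h.congr (fun x hx => ?_) ?_ <;>
  · exact (integral_congr (hGe.mono (uIcc_subset_Icc hc (by assumption)))).symm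

theorem eqOn_of_hasDerivWithinAt {c : ℝ} (hc : c ∈ Icc A B) {u v d : ℝ → E}
    (hu : ∀ y ∈ Icc A B, HasDerivWithinAt u (d y) (Icc A B) y)
    (hv : ∀ y ∈ Icc A B, HasDerivWithinAt v (d y) (Icc A B) y) (huv : u c = v c) :
    EqOn u v (Icc A B) := by
  intro y hy
  have h := (convex_Icc A B).norm_image_sub_le_of_norm_hasDerivWithin_le (C := 0)
    (fun x hx => (hu x hx).sub (hv x hx)) (by simp) hc hy
  simp only [Pi.sub_apply, huv, sub_self, sub_zero, zero_mul] at h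
  exact sub_eq_zero.1 (norm_le_zero_iff.1 h)

theorem contDiffOn_one_of_hasDerivWithinAt (hAB : A < B) {u u' : ℝ → E}
    (hu : ∀ y ∈ Icc A B, HasDerivWithinAt u (u' y) (Icc A B) y)
    (hu' : ContinuousOn u' (Icc A B)) : ContDiffOn ℝ 1 u (Icc A B) := by
  rw [contDiffOn_one_iff_derivWithin (uniqueDiffOn_Icc hAB)]
  exact ⟨fun y hy => (hu y hy).differentiableWithinAt,
    hu'.congr fun y hy => (hu y hy).derivWithin (uniqueDiffOn_Icc hAB y hy)⟩

theorem contDiffOn_two_of_hasDerivWithinAt (hAB : A < B) {u u' : ℝ → E}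
    (hu : ∀ y ∈ Icc A B, HasDerivWithinAt u (u' y) (Icc A B) y)
    (hu' : ContDiffOn ℝ 1 u' (Icc A B)) : ContDiffOn ℝ 2 u (Icc A B) := by
  rw [← one_add_one_eq_two, contDiffOn_succ_iff_derivWithin (uniqueDiffOn_Icc hAB)]
  exact ⟨fun y hy => (hu y hy).differentiableWithinAt, by simp,
    hu'.congr fun y hy => (hu y hy).derivWithin (uniqueDiffOn_Icc hAB y hy)⟩

/-- A `C²` function on a segment extends to a `C²` function on the line. -/
theorem exists_C2_extension [CompleteSpace E] (hAB : A < B) {h : ℝ → E}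
    (hh : ContDiffOn ℝ 2 h (Icc A B)) :
    ∃ H H' H'' : ℝ → E, Continuous H'' ∧ (∀ x, HasDerivAt H (H' x) x) ∧
      (∀ x, HasDerivAt H' (H'' x) x) ∧ EqOn H h (Icc A B) ∧
      EqOn H'' (derivWithin (derivWithin h (Icc A B)) (Icc A B)) (Icc A B) := by
  rw [← one_add_one_eq_two, contDiffOn_succ_iff_derivWithin (uniqueDiffOn_Icc hAB)] at hh
  obtain ⟨hd, -, hh⟩ := hh
  rw [contDiffOn_one_iff_derivWithin (uniqueDiffOn_Icc hAB)] at hh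
  obtain ⟨hd', hc⟩ := hh
  set h' := derivWithin h (Icc A B)
  set h'' := derivWithin h' (Icc A B)
  have hAm : A ∈ Icc A B := left_mem_Icc.2 hAB.le
  let H'' := IccExtend hAB.le ((Icc A B).domRestrict h'')
  have hH'' : Continuous H'' := (continuousOn_iff_continuous_domRestrict.1 hc).Icc_extend'
  have e'' : EqOn H'' h'' (Icc A B) := fun x hx => by
    simp only [H'', IccExtend_of_mem _ _ hx]; rfl
  let H' : ℝ → E := fun x => h' A + ∫ s in A..x, H'' s
  have dH' : ∀ x, HasDerivAt H' (H'' x) x := fun x =>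
    ((hH''.integral_hasStrictDerivAt A x).hasDerivAt).const_add _
  have hH' : Continuous H' := continuous_iff_continuousAt.2 fun x => (dH' x).continuousAt
  let H : ℝ → E := fun x => h A + ∫ s in A..x, H' s
  have dH : ∀ x, HasDerivAt H (H' x) x := fun x =>
    ((hH'.integral_hasStrictDerivAt A x).hasDerivAt).const_add _
  have e' : EqOn H' h' (Icc A B) :=
    eqOn_of_hasDerivWithinAt hAm (fun y _ => (dH' y).hasDerivWithinAt)
      (fun y hy => by rw [e'' hy]; exact (hd' y hy).hasDerivWithinAt) (by simp [H'])
  have e : EqOn H h (Icc A B) :=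
    eqOn_of_hasDerivWithinAt hAm (fun y _ => (dH y).hasDerivWithinAt)
      (fun y hy => by rw [e' hy]; exact (hd y hy).hasDerivWithinAt) (by simp [H])
  exact ⟨H, H', H'', hH'', dH, dH', e, e''⟩

end Interval

/-! ### The coefficients and the Liouville variable -/

section Coefficients

variable {A B A₀ : ℝ} {p q w : ℝ → ℝ} {f : ℝ → ℂ}

theorem IsAdmissible.continuousOn_sqrt_div (H : IsAdmissible p q w A B) :
    ContinuousOn (fun s => Real.sqrt (w s / p s)) (Icc A B) :=
  (H.contDiffOn_w.continuousOn.div H.contDiffOn_p.continuousOn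
    fun y hy => (H.p_pos y hy).ne').sqrt

theorem IsAdmissible.sqrt_div_pos (H : IsAdmissible p q w A B) {y : ℝ} (hy : y ∈ Icc A B) :
    0 < Real.sqrt (w y / p y) :=
  Real.sqrt_pos.2 (div_pos (H.w_pos y hy) (H.p_pos y hy))

theorem IsAdmissible.hasDerivWithinAt_liouville (H : IsAdmissible p q w A B)
    (hA₀ : A₀ ∈ Icc A B) {y : ℝ} (hy : y ∈ Icc A B) :
    HasDerivWithinAt (liouville p w A₀) (Real.sqrt (w y / p y)) (Icc A B) y :=
  hasDerivWithinAt_primitive hA₀ H.continuousOn_sqrt_div hy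

theorem liouville_self : liouville p w A₀ A₀ = 0 := by simp [liouville]

theorem IsAdmissible.continuousOn_liouville (H : IsAdmissible p q w A B) (hA₀ : A₀ ∈ Icc A B) :
    ContinuousOn (liouville p w A₀) (Icc A B) := fun _ hy =>
  (H.hasDerivWithinAt_liouville hA₀ hy).continuousWithinAt

theorem IsAdmissible.strictMonoOn_liouville (H : IsAdmissible p q w A B) (hA₀ : A₀ ∈ Icc A B) :
    StrictMonoOn (liouville p w A₀) (Icc A B) := by
  refine strictMonoOn_of_hasDerivWithinAt_pos (convex_Icc A B) (H.continuousOn_liouville hA₀)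
    (fun y hy => (H.hasDerivWithinAt_liouville hA₀ (interior_subset hy)).mono interior_subset)
    fun y hy => H.sqrt_div_pos (interior_subset hy)

theorem IsAdmissible.abs_liouville_le (H : IsAdmissible p q w A B) (hA₀ : A₀ ∈ Icc A B) {y : ℝ}
    (hy : y ∈ Icc A B) : |liouville p w A₀ y| ≤ halfLength p w A B A₀ := by
  have hm := (H.strictMonoOn_liouville hA₀).monotoneOn
  have hAB : A ≤ B := hA₀.1.trans hA₀.2
  have h1 := hm (left_mem_Icc.2 hAB) hy hy.1
  have h2 := hm hy (right_mem_Icc.2 hAB) hy.2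
  exact abs_le'.2 ⟨h2.trans (le_max_right _ _), (neg_le_neg h1).trans (le_max_left _ _)⟩

theorem IsAdmissible.halfLength_pos (H : IsAdmissible p q w A B) (hA₀ : A₀ ∈ Icc A B)
    (hAB : A < B) : 0 < halfLength p w A B A₀ := by
  have hm := (H.strictMonoOn_liouville hA₀) (left_mem_Icc.2 hAB.le) (right_mem_Icc.2 hAB.le) hAB
  have h1 : -liouville p w A₀ A ≤ _ := le_max_left _ (liouville p w A₀ B)
  have h2 : liouville p w A₀ B ≤ _ := le_max_right (-liouville p w A₀ A) _
  rw [halfLength]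
  linarith

theorem IsAdmissible.uIcc_liouville_subset (H : IsAdmissible p q w A B) (hA₀ : A₀ ∈ Icc A B)
    {y : ℝ} (hy : y ∈ Icc A B) :
    uIcc (-liouville p w A₀ y) (liouville p w A₀ y) ⊆
      Icc (-halfLength p w A B A₀) (halfLength p w A B A₀) := by
  have h := abs_le.1 (H.abs_liouville_le hA₀ hy)
  exact uIcc_subset_Icc ⟨by linarith, by linarith⟩ ⟨by linarith, by linarith⟩

theorem IsAdmissible.rho_pos (H : IsAdmissible p q w A B) {y : ℝ} (hy : y ∈ Icc A B) :
    0 < rho p w y :=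
  Real.rpow_pos_of_pos (mul_pos (H.p_pos y hy) (H.w_pos y hy)) _

theorem IsAdmissible.rho_ne_zero (H : IsAdmissible p q w A B) {y : ℝ} (hy : y ∈ Icc A B) :
    (rho p w y : ℂ) ≠ 0 :=
  Complex.ofReal_ne_zero.2 (H.rho_pos hy).ne'

theorem IsAdmissible.p_ne_zero (H : IsAdmissible p q w A B) {y : ℝ} (hy : y ∈ Icc A B) :
    (p y : ℂ) ≠ 0 :=
  Complex.ofReal_ne_zero.2 (H.p_pos y hy).ne'

theorem IsAdmissible.w_ne_zero (H : IsAdmissible p q w A B) {y : ℝ} (hy : y ∈ Icc A B) :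
    (w y : ℂ) ≠ 0 :=
  Complex.ofReal_ne_zero.2 (H.w_pos y hy).ne'

theorem IsAdmissible.contDiffOn_rho (H : IsAdmissible p q w A B) :
    ContDiffOn ℝ 1 (rho p w) (Icc A B) :=
  (H.contDiffOn_p.mul H.contDiffOn_w).rpow_const_of_ne fun y hy =>
    (mul_pos (H.p_pos y hy) (H.w_pos y hy)).ne'

theorem IsAdmissible.rho_sq (H : IsAdmissible p q w A B) {y : ℝ} (hy : y ∈ Icc A B) :
    rho p w y ^ 2 = Real.sqrt (p y * w y) := by
  rw [rho, ← Real.rpow_natCast, ← Real.rpow_mul (mul_pos (H.p_pos y hy) (H.w_pos y hy)).le,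
    Real.sqrt_eq_rpow]
  norm_num

theorem IsAdmissible.p_mul_sqrt_div (H : IsAdmissible p q w A B) {y : ℝ} (hy : y ∈ Icc A B) :
    (p y : ℂ) * (Real.sqrt (w y / p y) : ℂ) = (rho p w y : ℂ) ^ 2 := by
  have hp := H.p_pos y hy
  rw [← Complex.ofReal_pow, H.rho_sq hy, ← Complex.ofReal_mul, Complex.ofReal_inj,
    Real.sqrt_div' _ hp.le, Real.sqrt_mul hp.le]
  have := Real.sqrt_pos.2 hp
  field_simp
  rw [Real.sq_sqrt hp.le, mul_comm]

theorem IsAdmissible.rho_sq_mul_sqrt_div (H : IsAdmissible p q w A B) {y : ℝ}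
    (hy : y ∈ Icc A B) : (rho p w y : ℂ) ^ 2 * (Real.sqrt (w y / p y) : ℂ) = w y := by
  have hp := H.p_pos y hy
  rw [← H.p_mul_sqrt_div hy, mul_assoc, ← Complex.ofReal_mul,
    Real.mul_self_sqrt (div_pos (H.w_pos y hy) hp).le, ← Complex.ofReal_mul, Complex.ofReal_inj]
  field_simp

theorem IsSolution.hasDerivWithinAt (hf : IsSolution p q A B f) {y : ℝ} (hy : y ∈ Icc A B) :
    HasDerivWithinAt f (derivWithin f (Icc A B) y) (Icc A B) y :=
  (hf.differentiableOn y hy).hasDerivWithinAt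

theorem IsSolution.hasDerivWithinAt_mul (hf : IsSolution p q A B f) {y : ℝ} (hy : y ∈ Icc A B) :
    HasDerivWithinAt (fun z => (p z : ℂ) * derivWithin f (Icc A B) z) (q y * f y) (Icc A B) y := by
  have := (hf.differentiableOn_mul_deriv y hy).hasDerivWithinAt
  rwa [sub_eq_zero.1 (hf.eq_zero y hy)] at this

theorem IsSolution.continuousOn_deriv (H : IsAdmissible p q w A B) (hf : IsSolution p q A B f) :
    ContinuousOn (derivWithin f (Icc A B)) (Icc A B) := by
  have h : ContinuousOn (fun z => (p z : ℂ) * derivWithin f (Icc A B) z / p z) (Icc A B) :=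
    hf.differentiableOn_mul_deriv.continuousOn.div
      (Complex.continuous_ofReal.comp_continuousOn H.contDiffOn_p.continuousOn)
      fun y hy => H.p_ne_zero hy
  exact h.congr fun y hy => by field_simp [H.p_ne_zero hy]

/-- The logarithmic derivative of `ρ f` in the Liouville variable, extended to the line. -/
theorem exists_logDeriv_extension (hlt : A < B) (hA₀ : A₀ ∈ Icc A B) (H : IsAdmissible p q w A B)
    (hf : IsSolution p q A B f) (hf_ne : ∀ y ∈ Icc A B, f y ≠ 0) :
    ∃ (θ : ℝ → ℂ) (C : ℝ), Continuous θ ∧ (∀ x, ‖θ x‖ ≤ C) ∧ ∀ y ∈ Icc A B,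
      θ (liouville p w A₀ y) * (Real.sqrt (w y / p y) : ℂ) =
        ((derivWithin (rho p w) (Icc A B) y : ℝ) : ℂ) / rho p w y + derivWithin f (Icc A B) y / f y := by
  let η : ℝ → ℂ := fun y => (((derivWithin (rho p w) (Icc A B) y : ℝ) : ℂ) / rho p w y +
    derivWithin f (Icc A B) y / f y) / (Real.sqrt (w y / p y) : ℂ)
  have hofR : ∀ {g : ℝ → ℝ}, ContinuousOn g (Icc A B) →
      ContinuousOn (fun y => (g y : ℂ)) (Icc A B) := fun hg =>
    Complex.continuous_ofReal.comp_continuousOn hg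
  have hη : ContinuousOn η (Icc A B) := by
    refine ContinuousOn.div (.add (.div (hofR ?_) (hofR H.contDiffOn_rho.continuousOn)
      fun y hy => H.rho_ne_zero hy) (.div (hf.continuousOn_deriv H)
      hf.differentiableOn.continuousOn hf_ne)) (hofR H.continuousOn_sqrt_div)
      fun y hy => Complex.ofReal_ne_zero.2 (H.sqrt_div_pos hy).ne'
    exact ((contDiffOn_one_iff_derivWithin (uniqueDiffOn_Icc hlt)).1 H.contDiffOn_rho).2
  -- `l` is a closed embedding of the segment, so that Tietze's theorem applies
  have he : IsClosedEmbedding ((Icc A B).domRestrict (liouville p w A₀)) :=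
    (continuousOn_iff_continuous_domRestrict.1 (H.continuousOn_liouville hA₀)).isClosedEmbedding
      (injOn_iff_injective.1 (H.strictMonoOn_liouville hA₀).injOn)
  obtain ⟨θ₀, hθ₀⟩ := ContinuousMap.exists_extension he
    ⟨(Icc A B).domRestrict η, continuousOn_iff_continuous_domRestrict.1 hη⟩
  have hb := (H.halfLength_pos hA₀ hlt)
  have hbb : -halfLength p w A B A₀ ≤ halfLength p w A B A₀ := by linarith
  obtain ⟨C, hC⟩ := (isCompact_Icc (a := -halfLength p w A B A₀)
    (b := halfLength p w A B A₀)).exists_bound_of_continuousOn θ₀.continuous.continuousOn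
  refine ⟨fun x => θ₀ (projIcc _ _ hbb x), C, by fun_prop, fun x => hC _ (projIcc _ _ hbb x).2,
    fun y hy => ?_⟩
  beta_reduce
  rw [projIcc_of_mem hbb (abs_le.1 (H.abs_liouville_le hA₀ hy))]
  have h := DFunLike.congr_fun hθ₀ (⟨y, hy⟩ : Icc A B)
  change θ₀ (liouville p w A₀ y) = η y at h
  change θ₀ (liouville p w A₀ y) * _ = _
  rw [h]
  exact div_mul_cancel₀ _ (Complex.ofReal_ne_zero.2 (H.sqrt_div_pos hy).ne')

end Coefficients

/-! ### Existence of the kernel -/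

section Kernel

variable {A B A₀ : ℝ} {p q w : ℝ → ℝ} {f : ℝ → ℂ}

theorem opT_normT (k : ℝ → ℝ → ℂ) (h : ℝ → ℂ) (y : ℝ) :
    opT p w A₀ (fun y t => k (liouville p w A₀ y) t / rho p w y) h y =
      normT k h (liouville p w A₀ y) / rho p w y := by
  simp only [opT, normT, div_mul_eq_mul_div, intervalIntegral.integral_div, add_div]

theorem IsAdmissible.opT_congr (H : IsAdmissible p q w A B) (hA₀ : A₀ ∈ Icc A B)
    (K : ℝ → ℝ → ℂ) {g h : ℝ → ℂ}
    (hgh : EqOn g h (Icc (-halfLength p w A B A₀) (halfLength p w A B A₀))) {y : ℝ}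
    (hy : y ∈ Icc A B) : opT p w A₀ K g y = opT p w A₀ K h y := by
  have hs := H.uIcc_liouville_subset hA₀ hy
  simp only [opT]
  rw [hgh (hs right_mem_uIcc)]
  congr 1
  refine integral_congr fun t ht => ?_
  simp only [hgh (hs ht)]

/-- In the original variable, the first-order relations `(∂ - θ) v = d`, `(∂ + θ) d = e` say that
`u = v / ρ` solves `C u = e / ρ`. -/
theorem hasDerivWithinAt_of_system (hA₀ : A₀ ∈ Icc A B)
    (H : IsAdmissible p q w A B) (hf : IsSolution p q A B f) (hf_ne : ∀ y ∈ Icc A B, f y ≠ 0)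
    {θ : ℝ → ℂ} (hθ : ∀ y ∈ Icc A B, θ (liouville p w A₀ y) * (Real.sqrt (w y / p y) : ℂ) =
      ((derivWithin (rho p w) (Icc A B) y : ℝ) : ℂ) / rho p w y + derivWithin f (Icc A B) y / f y)
    {v d e : ℝ → ℂ} (hv : ∀ x, HasDerivAt v (θ x * v x + d x) x)
    (hd : ∀ x, HasDerivAt d (-(θ x * d x) + e x) x) {y : ℝ} (hy : y ∈ Icc A B) :
    HasDerivWithinAt (fun y => v (liouville p w A₀ y) / rho p w y)
      (((p y : ℂ) * derivWithin f (Icc A B) y * (v (liouville p w A₀ y) / rho p w y / f y) +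
        rho p w y * d (liouville p w A₀ y)) / p y) (Icc A B) y ∧
    HasDerivWithinAt (fun y =>
      (p y : ℂ) * derivWithin f (Icc A B) y * (v (liouville p w A₀ y) / rho p w y / f y) +
        rho p w y * d (liouville p w A₀ y))
      (q y * (v (liouville p w A₀ y) / rho p w y) +
        w y * (e (liouville p w A₀ y) / rho p w y)) (Icc A B) y := by
  have hl := H.hasDerivWithinAt_liouville hA₀ hy
  have hρ : HasDerivWithinAt (fun y => (rho p w y : ℂ))
      ((derivWithin (rho p w) (Icc A B) y : ℝ) : ℂ) (Icc A B) y :=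
    ((H.contDiffOn_rho.differentiableOn one_ne_zero) y hy).hasDerivWithinAt.ofReal_comp
  have hvl := (hv (liouville p w A₀ y)).scomp_hasDerivWithinAt y hl
  have hdl := (hd (liouville p w A₀ y)).scomp_hasDerivWithinAt y hl
  have hρ0 := H.rho_ne_zero hy
  have hp0 := H.p_ne_zero hy
  have hf0 := hf_ne y hy
  have hθy := hθ y hy
  have hpl := H.p_mul_sqrt_div hy
  have hρl := H.rho_sq_mul_sqrt_div hy
  simp only [Function.comp_def, Complex.real_smul] at hvl hdl
  set s : ℂ := (Real.sqrt (w y / p y) : ℂ)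
  set L := liouville p w A₀ y
  set ρ' : ℂ := ((derivWithin (rho p w) (Icc A B) y : ℝ) : ℂ)
  set f' := derivWithin f (Icc A B) y
  -- the logarithmic derivative of `ρ` cancels against the corresponding part of `θ`
  have hu : HasDerivWithinAt (fun y => v (liouville p w A₀ y) / rho p w y)
      (f' / f y * (v L / rho p w y) + s * d L / rho p w y) (Icc A B) y := by
    refine (hvl.div hρ hρ0).congr_deriv ?_
    have : s * (θ L * v L + d L) = (ρ' / rho p w y + f' / f y) * v L + s * d L := by
      rw [← hθy]; ring
    rw [this]
    field_simp
    ring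
  refine ⟨hu.congr_deriv ?_, ?_⟩
  · have hs : s = rho p w y ^ 2 / p y := by field_simp; rw [← hpl]; ring
    rw [hs]
    field_simp
  · refine (((hf.hasDerivWithinAt_mul hy).mul (hu.div (hf.hasDerivWithinAt hy) hf0)).add
      (hρ.mul hdl)).congr_deriv ?_
    have h1 : s * (-(θ L * d L) + e L) = -(ρ' / rho p w y + f' / f y) * d L + s * e L := by
      rw [← hθy]; ring
    rw [h1, ← hρl]
    change q y * f y * (v L / rho p w y / f y) + p y * f' * _ + _ = _
    have h2 : (p y : ℂ) * f' * (((f' / f y * (v L / rho p w y) + s * d L / rho p w y) * f y -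
        v L / rho p w y * f') / f y ^ 2) = rho p w y * d L * f' / f y := by
      have : ((f' / f y * (v L / rho p w y) + s * d L / rho p w y) * f y -
        v L / rho p w y * f') / f y ^ 2 = s * d L / rho p w y / f y := by field_simp; ring
      rw [this]
      calc _ = p y * s * (f' * d L / rho p w y / f y) := by ring
        _ = _ := by rw [hpl]; field_simp
    rw [h2]
    field_simp
    ring

/-- The kernel is `k (l y, t) / ρ y`, where `k` is the kernel of the normalised operator. -/
theorem exists_isTransmutationKernel (hAB : A < B) (hA₀ : A₀ ∈ Icc A B)
    (H : IsAdmissible p q w A B) (hf : IsSolution p q A B f) (hf_ne : ∀ y ∈ Icc A B, f y ≠ 0)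
    (hf_A₀ : f A₀ = 1 / (rho p w A₀ : ℂ)) :
    ∃ K : ℝ → ℝ → ℂ, IsTransmutationKernel p q w A B A₀ f K := by
  obtain ⟨θ, C, hθc, hθC, hθ⟩ := exists_logDeriv_extension hAB hA₀ H hf hf_ne
  obtain ⟨k, k', hk, hk', hkk'⟩ := exists_normalized_kernels hθc hθC
  have hud := uniqueDiffOn_Icc hAB
  have hb := H.halfLength_pos hA₀ hAB
  have hofR : ∀ {g : ℝ → ℝ}, ContinuousOn g (Icc A B) →
      ContinuousOn (fun y => (g y : ℂ)) (Icc A B) := fun hg =>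
    Complex.continuous_ofReal.comp_continuousOn hg
  have hpC : ContDiffOn ℝ 1 (fun y => (p y : ℂ)) (Icc A B) :=
    Complex.ofRealCLM.contDiff.comp_contDiffOn H.contDiffOn_p
  -- the relations of the system for the extension of a `C²` function `h`
  have main : ∀ h : ℝ → ℂ,
      ContDiffOn ℝ 2 h (Icc (-halfLength p w A B A₀) (halfLength p w A B A₀)) →
      ∃ G : ℝ → ℂ,
        let T := opT p w A₀ (fun y t => k (liouville p w A₀ y) t / rho p w y)
        let h'' := derivWithin (derivWithin h
          (Icc (-halfLength p w A B A₀) (halfLength p w A B A₀)))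
          (Icc (-halfLength p w A B A₀) (halfLength p w A B A₀))
        ContinuousOn (T h'') (Icc A B) ∧
        (∀ y ∈ Icc A B, HasDerivWithinAt (T h) (G y / p y) (Icc A B) y) ∧
        (∀ y ∈ Icc A B, HasDerivWithinAt G (q y * T h y + w y * T h'' y) (Icc A B) y) := by
    intro h hh
    obtain ⟨g, g', g'', hg'', dg, dg', eg, eg''⟩ := exists_C2_extension (by linarith) hh
    have hg' : Continuous g' := continuous_iff_continuousAt.2 fun x => (dg' x).continuousAt
    have hsys := fun y (hy : y ∈ Icc A B) => hasDerivWithinAt_of_system hA₀ H hf hf_ne hθ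
      (fun x => (hkk' g g' hg' dg x).1) (fun x => (hkk' g' g'' hg'' dg' x).2) hy
    have e1 := fun y (hy : y ∈ Icc A B) => (opT_normT (p := p) (w := w) (A₀ := A₀) k g y).symm.trans
      (H.opT_congr hA₀ _ eg hy)
    have e2 := fun y (hy : y ∈ Icc A B) =>
      (opT_normT (p := p) (w := w) (A₀ := A₀) k g'' y).symm.trans (H.opT_congr hA₀ _ eg'' hy)
    -- `G` is `p (T h)'`, and its derivative is continuous although `θ` is not differentiable
    refine ⟨_, ?_, fun y hy => ((hsys y hy).1.congr (fun z hz => (e1 z hz).symm) (e1 y hy).symm),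
      fun y hy => ?_⟩
    · have hc : Continuous (normT k g'') := by
        have h1 := continuous_parametric_primitive_of_continuous (a₀ := 0)
          (μ := MeasureTheory.volume) (f := fun x t => k x t * g'' t)
          (by simp only [Function.uncurry_def]; fun_prop)
        have e : normT k g'' = fun x => g'' x + ((∫ t in (0 : ℝ)..x, k x t * g'' t) -
            ∫ t in (0 : ℝ)..(-x), k x t * g'' t) := by
          funext x
          have hi : ∀ a b, IntervalIntegrable (fun t => k x t * g'' t) MeasureTheory.volume a b :=
            fun a b => Continuous.intervalIntegrable (by fun_prop) _ _
          rw [normT, integral_interval_sub_left (hi _ _) (hi _ _)]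
        rw [e]
        refine hg''.add (Continuous.sub ?_ ?_)
        · exact h1.comp (by fun_prop : Continuous fun x : ℝ => (x, x))
        · exact h1.comp (by fun_prop : Continuous fun x : ℝ => (x, -x))
      exact ((hc.comp_continuousOn (H.continuousOn_liouville hA₀)).div
        (hofR H.contDiffOn_rho.continuousOn) fun y hy => H.rho_ne_zero hy).congr
        fun y hy => (e2 y hy).symm
    · have := (hsys y hy).2
      rwa [e1 y hy, e2 y hy] at this
  refine ⟨fun y t => k (liouville p w A₀ y) t / rho p w y, ?_, fun h hh => ?_, fun h hh y hy => ?_,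
    ?_⟩
  · have h1 : ContinuousOn (fun z : ℝ × ℝ => (liouville p w A₀ z.1, z.2))
        (kernelDomain p w A B A₀) :=
      ((H.continuousOn_liouville hA₀).comp continuousOn_fst fun z hz => hz.1).prodMk
        continuousOn_snd
    exact (hk.comp_continuousOn h1).div ((hofR H.contDiffOn_rho.continuousOn).comp
      continuousOn_fst fun z hz => hz.1) fun z hz => H.rho_ne_zero hz.1
  · obtain ⟨G, hT, hu, hG⟩ := main h hh
    have hG1 : ContDiffOn ℝ 1 G (Icc A B) := by
      refine contDiffOn_one_of_hasDerivWithinAt hAB hG ?_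
      exact ((hofR H.continuousOn_q).mul fun y hy => (hu y hy).continuousWithinAt).add
        ((hofR H.contDiffOn_w.continuousOn).mul hT)
    refine contDiffOn_two_of_hasDerivWithinAt hAB hu ?_
    simp only [div_eq_mul_inv]
    exact hG1.mul (hpC.inv fun y hy => H.p_ne_zero hy)
  · obtain ⟨G, hT, hu, hG⟩ := main h hh
    have e : EqOn (fun z => (p z : ℂ) * derivWithin (opT p w A₀
        (fun y t => k (liouville p w A₀ y) t / rho p w y) h) (Icc A B) z) G (Icc A B) := by
      intro z hz
      simp only [(hu z hz).derivWithin (hud z hz)]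
      rw [mul_div_cancel₀ _ (H.p_ne_zero hz)]
    rw [opC, derivWithin_congr e (e hy), (hG y hy).derivWithin (hud y hy)]
    have := H.w_ne_zero hy
    field_simp
    ring
  · have h0 := fun x => (hkk' (fun _ => 1) (fun _ => 0) continuous_const
      (fun x => hasDerivAt_const x 1) x).1
    have h00 : ∀ j : ℝ → ℝ → ℂ, normT j (fun _ => 0) = fun _ => 0 := fun j => by
      funext x; simp [normT]
    rw [h00] at h0
    have hsys := fun y (hy : y ∈ Icc A B) => (hasDerivWithinAt_of_system (e := fun _ => 0)
      (d := fun _ => 0) hA₀ H hf hf_ne hθ h0 (fun x => by simpa using hasDerivAt_const x 0) hy).1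
    have hq : EqOn (fun y => normT k (fun _ => 1) (liouville p w A₀ y) / rho p w y / f y)
        (fun _ => 1) (Icc A B) := by
      refine eqOn_of_hasDerivWithinAt (d := fun _ => 0) hA₀ (fun y hy => ?_)
        (fun y _ => hasDerivWithinAt_const _ _ _) ?_
      · refine ((hsys y hy).div (hf.hasDerivWithinAt hy) (hf_ne y hy)).congr_deriv ?_
        have h1 := hf_ne y hy
        have h2 := H.p_ne_zero hy
        have h3 := H.rho_ne_zero hy
        field_simp
        ring
      · have := H.rho_ne_zero hA₀
        simp [liouville_self, normT, hf_A₀, this]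
    intro y hy
    rw [opT_normT]
    have := hq hy
    exact (div_eq_one_iff_eq (hf_ne y hy)).1 this

/-! ### Formal powers -/

/-- The factor `Y^(k)` or `Ỹ^(k)` of the formal power `Φ_k`. -/
noncomputable def formalFactor (p w : ℝ → ℝ) (f : ℝ → ℂ) (A₀ : ℝ) (k : ℕ) : ℝ → ℂ :=
  if Odd k then Y p w f A₀ k else Ytilde p w f A₀ k

theorem Phi_eq (k : ℕ) (y : ℝ) : Phi p w f A₀ k y = f y * formalFactor p w f A₀ k y := by
  unfold Phi formalFactor
  split_ifs <;> rfl

theorem formalFactor_zero : formalFactor p w f A₀ 0 = fun _ => 1 := by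
  simp [formalFactor, Ytilde]

theorem formalFactor_one (y : ℝ) :
    formalFactor p w f A₀ 1 y = ∫ s in A₀..y, 1 / (f s ^ 2 * (p s : ℂ)) := by
  simp [formalFactor, Y]

/-- Two steps of the recursion, which look the same for both parities. -/
theorem formalFactor_add_two (n : ℕ) (y : ℝ) :
    formalFactor p w f A₀ (n + 2) y =
      ∫ s in A₀..y, ((n + 2 : ℂ) * (n + 1) * ∫ r in A₀..s,
        formalFactor p w f A₀ n r * (f r ^ 2 * (w r : ℂ))) * (1 / (f s ^ 2 * (p s : ℂ))) := by
  rcases Nat.even_or_odd n with hn | hn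
  · have h0 : ¬ Odd n := Nat.not_odd_iff_even.2 hn
    have h1 : Odd (n + 1) := hn.add_one
    have h2 : ¬ Odd (n + 2) := by rw [Nat.not_odd_iff_even]; exact hn.add even_two
    simp only [formalFactor, if_neg h0, if_neg h2]
    rw [Ytilde]
    simp only [if_neg h2]
    rw [← intervalIntegral.integral_const_mul]
    refine integral_congr fun s _ => ?_
    simp only [Ytilde, if_pos h1]
    push_cast
    ring
  · have h1 : ¬ Odd (n + 1) := by rw [Nat.not_odd_iff_even]; exact hn.add_one
    have h2 : Odd (n + 2) := hn.add_even even_two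
    simp only [formalFactor, if_pos hn, if_pos h2]
    rw [Y]
    simp only [if_pos h2]
    rw [← intervalIntegral.integral_const_mul]
    refine integral_congr fun s _ => ?_
    simp only [Y, if_neg h1]
    push_cast
    ring

/-- Reduction of order: a `C²` solution of `C u = f g` is determined by its Cauchy data at `A₀`
through two quadratures, since `p (u' f - f' u)` is a primitive of `f² w g` and `(u / f)'` is
the quotient of that function by `f² p`. -/
theorem eq_integral_of_opC_eq (hAB : A < B) (hA₀ : A₀ ∈ Icc A B)
    (H : IsAdmissible p q w A B) (hf : IsSolution p q A B f) (hf_ne : ∀ y ∈ Icc A B, f y ≠ 0)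
    {u g : ℝ → ℂ} (hu : ContDiffOn ℝ 2 u (Icc A B)) (hg : ContinuousOn g (Icc A B))
    (hug : ∀ y ∈ Icc A B, opC p q w A B u y = f y * g y) {u₁ : ℂ} (hu₀ : u A₀ = 0)
    (hu₁ : HasDerivWithinAt u u₁ (Icc A B) A₀) {y : ℝ} (hy : y ∈ Icc A B) :
    u y = f y * ∫ s in A₀..y, (p A₀ * u₁ * f A₀ + ∫ r in A₀..s, g r * (f r ^ 2 * (w r : ℂ))) *
      (1 / (f s ^ 2 * (p s : ℂ))) := by
  have hud := uniqueDiffOn_Icc hAB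
  have hofR : ∀ {g : ℝ → ℝ}, ContinuousOn g (Icc A B) →
      ContinuousOn (fun y => (g y : ℂ)) (Icc A B) := fun hg =>
    Complex.continuous_ofReal.comp_continuousOn hg
  rw [← one_add_one_eq_two, contDiffOn_succ_iff_derivWithin hud] at hu
  obtain ⟨hud', -, hu'⟩ := hu
  have hpu : DifferentiableOn ℝ (fun z => (p z : ℂ) * derivWithin u (Icc A B) z) (Icc A B) :=
    ((Complex.ofRealCLM.contDiff.comp_contDiffOn H.contDiffOn_p).mul hu').differentiableOn
      one_ne_zero
  have hdpu : ∀ y ∈ Icc A B, HasDerivWithinAt (fun z => (p z : ℂ) * derivWithin u (Icc A B) z)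
      (w y * (f y * g y) + q y * u y) (Icc A B) y := by
    intro y hy
    refine (hpu y hy).hasDerivWithinAt.congr_deriv ?_
    rw [← hug y hy, opC]
    have := H.w_ne_zero hy
    field_simp
    ring
  have hfc := hf.differentiableOn.continuousOn
  have hI : ContinuousOn (fun r => g r * (f r ^ 2 * (w r : ℂ))) (Icc A B) :=
    hg.mul ((hfc.pow 2).mul (hofR H.contDiffOn_w.continuousOn))
  -- Lagrange's identity
  have hW : EqOn (fun y => (p y : ℂ) * derivWithin u (Icc A B) y * f y -
      (p y : ℂ) * derivWithin f (Icc A B) y * u y)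
      (fun y => p A₀ * u₁ * f A₀ + ∫ r in A₀..y, g r * (f r ^ 2 * (w r : ℂ))) (Icc A B) := by
    refine eqOn_of_hasDerivWithinAt hA₀ (fun y hy => ?_)
      (fun y hy => (hasDerivWithinAt_primitive hA₀ hI hy).const_add _) ?_
    · refine (((hdpu y hy).mul (hf.hasDerivWithinAt hy)).sub ((hf.hasDerivWithinAt_mul hy).mul
        (hud' y hy).hasDerivWithinAt)).congr_deriv ?_
      ring
    · simp [hu₀, hu₁.derivWithin (hud A₀ hA₀)]
  have hJ : ContinuousOn (fun s => (p A₀ * u₁ * f A₀ + ∫ r in A₀..s, g r * (f r ^ 2 * (w r : ℂ))) *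
      (1 / (f s ^ 2 * (p s : ℂ)))) (Icc A B) := by
    refine ContinuousOn.mul (continuousOn_const.add fun y hy =>
      (hasDerivWithinAt_primitive hA₀ hI hy).continuousWithinAt) (continuousOn_const.div
      ((hfc.pow 2).mul (hofR H.contDiffOn_p.continuousOn)) fun y hy =>
        mul_ne_zero (pow_ne_zero _ (hf_ne y hy)) (H.p_ne_zero hy))
  have hφ : EqOn (fun y => u y / f y) (fun y => ∫ s in A₀..y, (p A₀ * u₁ * f A₀ +
      ∫ r in A₀..s, g r * (f r ^ 2 * (w r : ℂ))) * (1 / (f s ^ 2 * (p s : ℂ)))) (Icc A B) := by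
    refine eqOn_of_hasDerivWithinAt hA₀ (fun y hy => ?_)
      (fun y hy => hasDerivWithinAt_primitive hA₀ hJ hy) (by simp [hu₀])
    refine ((hud' y hy).hasDerivWithinAt.div (hf.hasDerivWithinAt hy)
      (hf_ne y hy)).congr_deriv ?_
    have hWy := hW hy
    simp only at hWy
    rw [← hWy]
    have h1 := hf_ne y hy
    have h2 := H.p_ne_zero hy
    field_simp
  have := hφ hy
  simp only at this
  rw [← this, mul_div_cancel₀ _ (hf_ne y hy)]

/-! ### Images of the powers under a transmutation operator -/

variable {K : ℝ → ℝ → ℂ}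

theorem IsTransmutationKernel.continuousOn_slice (hK : IsTransmutationKernel p q w A B A₀ f K)
    {y : ℝ} (hy : y ∈ Icc A B) :
    ContinuousOn (K y) (uIcc (-liouville p w A₀ y) (liouville p w A₀ y)) := by
  refine hK.continuousOn.comp (f := fun t => (y, t)) (by fun_prop) fun t ht => ⟨hy, ?_⟩
  rcases mem_uIcc.1 ht with h | h
  · exact (abs_le.2 h).trans (le_abs_self _)
  · rw [← abs_neg (liouville p w A₀ y)]
    exact (abs_le.2 ⟨by linarith [h.1], h.2⟩).trans (le_abs_self _)

theorem IsTransmutationKernel.intervalIntegrable (hK : IsTransmutationKernel p q w A B A₀ f K)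
    {h : ℝ → ℂ} (hh : Continuous h) {y : ℝ} (hy : y ∈ Icc A B) :
    IntervalIntegrable (fun t => K y t * h t) MeasureTheory.volume
      (-liouville p w A₀ y) (liouville p w A₀ y) :=
  ((hK.continuousOn_slice hy).mul hh.continuousOn).intervalIntegrable

/-- A kernel is bounded, since its domain is compact. -/
theorem IsTransmutationKernel.exists_bound (H : IsAdmissible p q w A B) (hA₀ : A₀ ∈ Icc A B)
    (hK : IsTransmutationKernel p q w A B A₀ f K) :
    ∃ C, ∀ z ∈ kernelDomain p w A B A₀, ‖K z.1 z.2‖ ≤ C := by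
  refine IsCompact.exists_bound_of_continuousOn ?_ hK.continuousOn
  set b := halfLength p w A B A₀
  have hc : IsCompact (Icc A B ×ˢ Icc (-b) b) := isCompact_Icc.prod isCompact_Icc
  have hl : ContinuousOn (fun z : ℝ × ℝ => |liouville p w A₀ z.1| - |z.2|)
      (Icc A B ×ˢ Icc (-b) b) :=
    (((H.continuousOn_liouville hA₀).comp continuousOn_fst fun z hz => hz.1).abs).sub
      continuousOn_snd.abs
  have := hl.preimage_isClosed_of_isClosed hc.isClosed (isClosed_Ici (a := (0 : ℝ)))
  convert hc.of_isClosed_subset this inter_subset_left using 1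
  ext z
  simp only [kernelDomain, mem_ofPred_eq, mem_inter_iff, mem_prod, mem_preimage, mem_Ici, sub_nonneg]
  exact ⟨fun h => ⟨⟨h.1, abs_le.1 (h.2.trans (H.abs_liouville_le hA₀ h.1))⟩, h.2⟩,
    fun h => ⟨h.1.1, h.2⟩⟩

theorem opT_at_base (h : ℝ → ℂ) : opT p w A₀ K h A₀ = h 0 / rho p w A₀ := by
  simp [opT, liouville_self]

/-- The integral term of `T [x ^ (m + 1)]` is `O (l ^ 2)` at `A₀`, so that only the explicit term
contributes to the derivative. -/
theorem IsTransmutationKernel.hasDerivWithinAt_opT_pow (H : IsAdmissible p q w A B)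
    (hA₀ : A₀ ∈ Icc A B) (hK : IsTransmutationKernel p q w A B A₀ f K) (m : ℕ) :
    HasDerivWithinAt (opT p w A₀ K fun x => (x : ℂ) ^ (m + 1))
      (if m = 0 then (Real.sqrt (w A₀ / p A₀) : ℂ) / rho p w A₀ else 0) (Icc A B) A₀ := by
  obtain ⟨C, hC⟩ := hK.exists_bound H hA₀
  have hl := H.hasDerivWithinAt_liouville hA₀ hA₀
  have hρ : HasDerivWithinAt (fun y => (rho p w y : ℂ))
      ((derivWithin (rho p w) (Icc A B) A₀ : ℝ) : ℂ) (Icc A B) A₀ :=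
    ((H.contDiffOn_rho.differentiableOn one_ne_zero) A₀ hA₀).hasDerivWithinAt.ofReal_comp
  have h1 := ((hl.ofReal_comp.pow (m + 1)).div hρ (H.rho_ne_zero hA₀))
  have h2 : HasDerivWithinAt (fun y => ∫ t in (-liouville p w A₀ y)..(liouville p w A₀ y),
      K y t * (t : ℂ) ^ (m + 1)) 0 (Icc A B) A₀ := by
    have hl2 : HasDerivWithinAt (fun y => liouville p w A₀ y ^ (m + 2)) 0 (Icc A B) A₀ :=
      (hl.pow (m + 2)).congr_deriv (by simp [liouville_self])
    rw [hasDerivWithinAt_iff_isLittleO] at hl2 ⊢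
    simp only [liouville_self, neg_zero, integral_same, smul_zero, sub_zero,
      ne_eq, Nat.add_eq_zero_iff, OfNat.ofNat_ne_zero, and_false, not_false_eq_true, zero_pow]
      at hl2 ⊢
    refine IsBigO.trans_isLittleO ?_ hl2
    refine IsBigO.of_bound (2 * C) (eventually_nhdsWithin_of_forall fun y hy => ?_)
    set L := liouville p w A₀ y
    have hC0 : 0 ≤ C := (norm_nonneg _).trans (hC (y, 0) ⟨hy, by simp⟩)
    have hb := norm_integral_le_of_norm_le_const (a := -L) (b := L)
      (f := fun t : ℝ => K y t * (t : ℂ) ^ (m + 1)) (C := C * |L| ^ (m + 1)) (fun t ht => by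
        have ht' : |t| ≤ |L| := by
          rcases mem_uIcc.1 (uIoc_subset_uIcc ht) with h | h
          · exact (abs_le.2 h).trans (le_abs_self _)
          · rw [← abs_neg L]
            exact (abs_le.2 ⟨by linarith [h.1], h.2⟩).trans (le_abs_self _)
        rw [norm_mul, norm_pow, Complex.norm_real, Real.norm_eq_abs]
        have := hC (y, t) ⟨hy, ht'⟩
        simp only at this
        gcongr)
    refine hb.trans (le_of_eq ?_)
    rw [sub_neg_eq_add, ← two_mul, abs_mul, abs_two, Real.norm_eq_abs, abs_pow]
    ring
  refine (h1.add h2).congr_deriv ?_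
  have := H.rho_ne_zero hA₀
  rcases eq_or_ne m 0 with rfl | hm
  · simp [liouville_self]
    field_simp
  · simp [liouville_self, hm]

theorem derivWithin_derivWithin_pow {b : ℝ} (hb : 0 < b) (n : ℕ) :
    EqOn (derivWithin (derivWithin (fun x : ℝ => (x : ℂ) ^ (n + 2)) (Icc (-b) b)) (Icc (-b) b))
      (fun x => (n + 2 : ℂ) * (n + 1) * (x : ℂ) ^ n) (Icc (-b) b) := by
  have hud := uniqueDiffOn_Icc (show -b < b by linarith)
  have h1 : ∀ (k : ℕ) (x : ℝ), HasDerivAt (fun x : ℝ => (x : ℂ) ^ (k + 1))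
      ((k + 1 : ℂ) * (x : ℂ) ^ k) x := fun k x => by
    simpa using (hasDerivAt_pow (k + 1) (x : ℂ)).comp_ofReal
  have e : EqOn (derivWithin (fun x : ℝ => (x : ℂ) ^ (n + 2)) (Icc (-b) b))
      (fun x => (n + 2 : ℂ) * (x : ℂ) ^ (n + 1)) (Icc (-b) b) := fun x hx => by
    rw [((h1 (n + 1) x).hasDerivWithinAt).derivWithin (hud x hx)]
    push_cast
    ring
  intro x hx
  rw [derivWithin_congr e (e hx), (((h1 n x).const_mul (n + 2 : ℂ)).hasDerivWithinAt).derivWithin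
    (hud x hx)]
  ring

/-- `T` maps the powers of the independent variable to the formal powers. -/
theorem IsTransmutationKernel.opT_pow (hAB : A < B) (hA₀ : A₀ ∈ Icc A B)
    (H : IsAdmissible p q w A B) (hf : IsSolution p q A B f) (hf_ne : ∀ y ∈ Icc A B, f y ≠ 0)
    (hf_A₀ : f A₀ = 1 / (rho p w A₀ : ℂ)) (hK : IsTransmutationKernel p q w A B A₀ f K) (n : ℕ) :
    ∀ y ∈ Icc A B, opT p w A₀ K (fun x => (x : ℂ) ^ n) y = Phi p w f A₀ n y := by
  have hpow : ∀ (n : ℕ) (s : Set ℝ), ContDiffOn ℝ 2 (fun x : ℝ => (x : ℂ) ^ n) s := fun n s =>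
    (Complex.ofRealCLM.contDiff.pow n).contDiffOn
  have hb := H.halfLength_pos hA₀ hAB
  induction n using Nat.twoStepInduction with
  | zero =>
    intro y hy
    simpa [Phi_eq, formalFactor_zero] using hK.map_one y hy
  | one =>
    intro y hy
    have hzero : ∀ y ∈ Icc A B, opC p q w A B (opT p w A₀ K fun x => (x : ℂ) ^ 1) y = f y * 0 := by
      intro y hy
      rw [hK.intertwines _ (hpow 1 _) y hy, mul_zero]
      set b := halfLength p w A B A₀
      have hud := uniqueDiffOn_Icc (show -b < b by linarith)
      have e : EqOn (derivWithin (fun x : ℝ => (x : ℂ) ^ 1) (Icc (-b) b)) (fun _ => 1)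
          (Icc (-b) b) := fun x hx => by
        have : HasDerivAt (fun x : ℝ => (x : ℂ) ^ 1) 1 x := by
          simpa using (hasDerivAt_id (x : ℂ)).comp_ofReal
        exact this.hasDerivWithinAt.derivWithin (hud x hx)
      rw [H.opT_congr hA₀ K (h := fun _ => 0) (fun x hx => by
        rw [derivWithin_congr e (e hx)]; simp) hy]
      simp [opT]
    have := eq_integral_of_opC_eq hAB hA₀ H hf hf_ne (hK.mapsTo _ (hpow 1 _)) (g := fun _ => 0)
      continuousOn_const hzero (by simp [opT_at_base])
      (hK.hasDerivWithinAt_opT_pow H hA₀ 0) hy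
    rw [this, Phi_eq, formalFactor_one]
    -- the normalisation `f A₀ = 1 / ρ A₀` makes the constant of integration equal to `1`
    have hc : (p A₀ : ℂ) * ((Real.sqrt (w A₀ / p A₀) : ℂ) / rho p w A₀) * f A₀ = 1 := by
      have h0 := H.rho_ne_zero hA₀
      rw [mul_div_assoc', H.p_mul_sqrt_div hA₀, hf_A₀]
      field_simp
    simp [hc]
  | more n ih _ =>
    intro y hy
    have hg : ∀ y ∈ Icc A B, opC p q w A B (opT p w A₀ K fun x => (x : ℂ) ^ (n + 2)) y =
        f y * ((n + 2 : ℂ) * (n + 1) * formalFactor p w f A₀ n y) := by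
      intro y hy
      rw [hK.intertwines _ (hpow _ _) y hy, H.opT_congr hA₀ K
        (derivWithin_derivWithin_pow hb n) hy]
      have hlin : opT p w A₀ K (fun x => (n + 2 : ℂ) * (n + 1) * (x : ℂ) ^ n) y =
          (n + 2 : ℂ) * (n + 1) * opT p w A₀ K (fun x => (x : ℂ) ^ n) y := by
        simp only [opT, mul_left_comm (K y _), intervalIntegral.integral_const_mul]
        ring
      rw [hlin, ih y hy, Phi_eq]
      ring
    have hcont : ContinuousOn (formalFactor p w f A₀ n) (Icc A B) := by
      have h1 : ContinuousOn (fun y => opT p w A₀ K (fun x => (x : ℂ) ^ n) y / f y) (Icc A B) :=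
        (hK.mapsTo _ (hpow n _)).continuousOn.div hf.differentiableOn.continuousOn hf_ne
      refine h1.congr fun y hy => ?_
      beta_reduce
      rw [ih y hy, Phi_eq, mul_div_cancel_left₀ _ (hf_ne y hy)]
    have := eq_integral_of_opC_eq hAB hA₀ H hf hf_ne (hK.mapsTo _ (hpow (n + 2) _))
      (continuousOn_const.mul hcont) hg (by simp [opT_at_base])
      (hK.hasDerivWithinAt_opT_pow H hA₀ (n + 1)) hy
    rw [this, Phi_eq, formalFactor_add_two]
    simp [mul_assoc]

/-! ### Moments and uniqueness of the kernel -/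

theorem eqOn_zero_of_moments_real {a b : ℝ} (hab : a < b) {g : ℝ → ℝ}
    (hg : ContinuousOn g (Icc a b)) (hm : ∀ n : ℕ, ∫ t in a..b, g t * t ^ n = 0) :
    EqOn g 0 (Icc a b) := by
  have hgu : ContinuousOn g (uIcc a b) := by rwa [uIcc_of_le hab.le]
  have hpoly : ∀ P : Polynomial ℝ, ∫ t in a..b, g t * P.eval t = 0 := by
    intro P
    have hi : ∀ n : ℕ, IntervalIntegrable (fun t => P.coeff n * (g t * t ^ n))
        MeasureTheory.volume a b := fun n =>
      (continuousOn_const.mul (hgu.mul (by fun_prop))).intervalIntegrable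
    have e : ∀ t, g t * P.eval t = ∑ n ∈ Finset.range (P.natDegree + 1),
        P.coeff n * (g t * t ^ n) := fun t => by
      rw [Polynomial.eval_eq_sum_range, Finset.mul_sum]
      exact Finset.sum_congr rfl fun n _ => by ring
    simp only [e]
    rw [integral_finsetSum fun n _ => hi n]
    simp [intervalIntegral.integral_const_mul, hm]
  obtain ⟨M, hM⟩ := isCompact_Icc.exists_bound_of_continuousOn hg
  have hM0 : 0 ≤ M := (norm_nonneg _).trans (hM a (left_mem_Icc.2 hab.le))
  -- `g - P` is uniformly small for a suitable polynomial `P`, which is orthogonal to `g`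
  have hsq : ∫ t in a..b, g t * g t ≤ 0 := by
    refine le_of_forall_pos_le_add fun ε hε => ?_
    obtain ⟨P, hP⟩ := exists_polynomial_near_of_continuousOn a b g hg
      (ε / ((M + 1) * (b - a))) (by have := sub_pos.2 hab; positivity)
    have h1 : ∫ t in a..b, g t * g t = ∫ t in a..b, g t * (g t - P.eval t) := by
      have hgg : IntervalIntegrable (fun t => g t * g t) MeasureTheory.volume a b :=
        (hgu.mul hgu).intervalIntegrable
      have hgP : IntervalIntegrable (fun t => g t * P.eval t) MeasureTheory.volume a b :=
        (hgu.mul P.continuous.continuousOn).intervalIntegrable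
      simp only [mul_sub]
      rw [intervalIntegral.integral_sub hgg hgP, hpoly, sub_zero]
    have h2 := norm_integral_le_of_norm_le_const (a := a) (b := b)
      (f := fun t => g t * (g t - P.eval t)) (C := M * (ε / ((M + 1) * (b - a)))) (fun t ht => by
        have ht' : t ∈ Icc a b := by rw [← uIcc_of_le hab.le]; exact uIoc_subset_uIcc ht
        rw [norm_mul]
        have h3 := (hP t ht').le
        rw [abs_sub_comm] at h3
        exact mul_le_mul (hM t ht') h3 (norm_nonneg _) hM0)
    rw [h1, zero_add]
    refine (le_abs_self _).trans (h2.trans ?_)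
    have hba := sub_pos.2 hab
    rw [abs_of_pos hba]
    have : M * (ε / ((M + 1) * (b - a))) * (b - a) = M / (M + 1) * ε := by field_simp
    rw [this]
    have h4 : M / (M + 1) ≤ 1 := by rw [div_le_one (by linarith)]; linarith
    nlinarith
  intro c hc
  by_contra hne
  have := integral_pos hab (hg.mul hg) (fun t _ => mul_self_nonneg _)
    ⟨c, hc, mul_self_pos.2 hne⟩
  exact this.not_ge hsq

/-- A continuous function on a segment all of whose moments vanish is zero. -/
theorem eqOn_zero_of_moments {a b : ℝ} (hab : a ≠ b) {g : ℝ → ℂ}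
    (hg : ContinuousOn g (uIcc a b)) (hm : ∀ n : ℕ, ∫ t in a..b, g t * (t : ℂ) ^ n = 0) :
    EqOn g 0 (uIcc a b) := by
  wlog hlt : a < b generalizing a b
  · have hba : b < a := lt_of_le_of_ne (not_lt.1 hlt) hab.symm
    rw [uIcc_comm] at hg ⊢
    exact this hab.symm hg (fun n => by rw [integral_symm, hm, neg_zero]) hba
  have hi : ∀ n : ℕ, IntervalIntegrable (fun t : ℝ => g t * (t : ℂ) ^ n)
      MeasureTheory.volume a b := fun n => (hg.mul (by fun_prop)).intervalIntegrable
  rw [uIcc_of_le hlt.le] at hg ⊢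
  have hre := eqOn_zero_of_moments_real hlt (Complex.continuous_re.comp_continuousOn hg) fun n => by
    have := Complex.reCLM.intervalIntegral_comp_comm (hi n)
    rw [hm, map_zero] at this
    rw [← this]
    refine integral_congr fun t _ => ?_
    simp [← Complex.ofReal_pow]
  have him := eqOn_zero_of_moments_real hlt (Complex.continuous_im.comp_continuousOn hg) fun n => by
    have := Complex.imCLM.intervalIntegral_comp_comm (hi n)
    rw [hm, map_zero] at this
    rw [← this]
    refine integral_congr fun t _ => ?_
    simp [← Complex.ofReal_pow]
  exact fun t ht => Complex.ext (hre ht) (him ht)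

variable {K' : ℝ → ℝ → ℂ}

/-- Uniqueness of the kernel: two kernels have the same moments on each slice. -/
theorem IsTransmutationKernel.unique (hAB : A < B) (hA₀ : A₀ ∈ Icc A B)
    (H : IsAdmissible p q w A B) (hf : IsSolution p q A B f) (hf_ne : ∀ y ∈ Icc A B, f y ≠ 0)
    (hf_A₀ : f A₀ = 1 / (rho p w A₀ : ℂ)) (hK : IsTransmutationKernel p q w A B A₀ f K)
    (hK' : IsTransmutationKernel p q w A B A₀ f K') :
    ∀ z ∈ kernelDomain p w A B A₀, K' z.1 z.2 = K z.1 z.2 := by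
  have off : ∀ y ∈ Icc A B, y ≠ A₀ → ∀ t, |t| ≤ |liouville p w A₀ y| → K' y t = K y t := by
    intro y hy hne t ht
    set L := liouville p w A₀ y with hL
    have hL0 : L ≠ 0 := fun h => hne ((H.strictMonoOn_liouville hA₀).injOn hy hA₀
      (by rw [← hL, h, liouville_self]))
    have hz := eqOn_zero_of_moments (a := -L) (b := L) (g := fun t => K' y t - K y t)
      (fun h => hL0 (by linarith)) ((hK'.continuousOn_slice hy).sub (hK.continuousOn_slice hy))
      fun n => by
        have h1 := (hK'.opT_pow hAB hA₀ H hf hf_ne hf_A₀ n y hy).trans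
          (hK.opT_pow hAB hA₀ H hf hf_ne hf_A₀ n y hy).symm
        simp only [opT, add_right_inj] at h1
        have hc : Continuous fun t : ℝ => (t : ℂ) ^ n := by fun_prop
        simp only [sub_mul]
        rw [intervalIntegral.integral_sub (hK'.intervalIntegrable hc hy)
          (hK.intervalIntegrable hc hy), h1, sub_self]
    have hmem : t ∈ uIcc (-L) L := by
      rcases abs_cases L with ⟨h, _⟩ | ⟨h, _⟩ <;> rw [h] at ht <;> have := abs_le.1 ht
      · exact mem_uIcc.2 (.inl this)
      · exact mem_uIcc.2 (.inr ⟨by linarith, this.2⟩)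
    exact sub_eq_zero.1 (hz hmem)
  rintro ⟨y, t⟩ ⟨hy, ht⟩
  rcases eq_or_ne y A₀ with rfl | hne
  · -- the slice over `A₀` is the single point `t = 0`, which is a limit of points of other slices
    obtain rfl : t = 0 := by simpa [liouville_self] using ht
    have hc : ∀ {K : ℝ → ℝ → ℂ}, IsTransmutationKernel p q w A B y f K →
        ContinuousOn (fun x => K x 0) (Icc A B) := fun hK =>
      hK.continuousOn.comp (f := fun x => (x, (0 : ℝ))) (by fun_prop) fun x hx => ⟨hx, by simp⟩
    refine EqOn.of_subset_closure (s := Icc A B \ {y}) (fun x hx => off x hx.1 hx.2 0 (by simp))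
      (hc hK') (hc hK) sdiff_subset (fun x hx => ?_) hy
    rcases eq_or_ne x y with rfl | hxy
    · rw [mem_closure_iff_clusterPt, ← accPt_principal_iff_clusterPt]
      exact (uniqueDiffOn_Icc hAB x hx).accPt
    · exact subset_closure ⟨hx, hxy⟩
  · exact off y hy hne t ht

theorem IsTransmutationKernel.transmutedHeatPoly_eq (hAB : A < B) (hA₀ : A₀ ∈ Icc A B)
    (H : IsAdmissible p q w A B) (hf : IsSolution p q A B f) (hf_ne : ∀ y ∈ Icc A B, f y ≠ 0)
    (hf_A₀ : f A₀ = 1 / (rho p w A₀ : ℂ)) (hK : IsTransmutationKernel p q w A B A₀ f K) (n : ℕ)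
    {y : ℝ} (hy : y ∈ Icc A B) (t : ℝ) :
    transmutedHeatPoly p w A₀ K n y t = ∑ k ∈ Finset.range (n / 2 + 1),
      coeff n k * Phi p w f A₀ (n - 2 * k) y * (t : ℂ) ^ k := by
  have hi : ∀ k : ℕ, IntervalIntegrable
      (fun s : ℝ => K y s * (coeff n k * (s : ℂ) ^ (n - 2 * k) * (t : ℂ) ^ k))
      MeasureTheory.volume (-liouville p w A₀ y) (liouville p w A₀ y) := fun k =>
    hK.intervalIntegrable (by fun_prop) hy
  simp only [transmutedHeatPoly, opT, heatPoly, Finset.mul_sum, Finset.sum_div]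
  rw [integral_finsetSum fun k _ => hi k, ← Finset.sum_add_distrib]
  refine Finset.sum_congr rfl fun k _ => ?_
  rw [← hK.opT_pow hAB hA₀ H hf hf_ne hf_A₀ _ y hy, opT]
  have e : ∀ s : ℝ, K y s * (coeff n k * (s : ℂ) ^ (n - 2 * k) * (t : ℂ) ^ k) =
      coeff n k * (t : ℂ) ^ k * (K y s * (s : ℂ) ^ (n - 2 * k)) := fun s => by ring
  simp only [e, intervalIntegral.integral_const_mul]
  ring

end Kernel

end TransmutedHeat

theorem corollaryA1 (A B A₀ : ℝ) (hAB : A < B) (hA₀ : A₀ ∈ Set.Icc A B)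
    (p q w : ℝ → ℝ) (hpqw : TransmutedHeat.IsAdmissible p q w A B)
    (f : ℝ → ℂ) (hf : TransmutedHeat.IsSolution p q A B f)
    (hf_ne : ∀ y ∈ Set.Icc A B, f y ≠ 0)
    (hf_A₀ : f A₀ = 1 / (TransmutedHeat.rho p w A₀ : ℂ)) :
    (∃ K : ℝ → ℝ → ℂ, TransmutedHeat.IsTransmutationKernel p q w A B A₀ f K ∧
      ∀ K' : ℝ → ℝ → ℂ, TransmutedHeat.IsTransmutationKernel p q w A B A₀ f K' →
        ∀ z ∈ TransmutedHeat.kernelDomain p w A B A₀, K' z.1 z.2 = K z.1 z.2) ∧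
    ∀ K : ℝ → ℝ → ℂ, TransmutedHeat.IsTransmutationKernel p q w A B A₀ f K →
      ∀ n : ℕ, ∀ y ∈ Set.Icc A B, ∀ t : ℝ,
        TransmutedHeat.transmutedHeatPoly p w A₀ K n y t =
          ∑ k ∈ Finset.range (n / 2 + 1),
            TransmutedHeat.coeff n k * TransmutedHeat.Phi p w f A₀ (n - 2 * k) y * (t : ℂ) ^ k := by
  obtain ⟨K, hK⟩ := TransmutedHeat.exists_isTransmutationKernel hAB hA₀ hpqw hf hf_ne hf_A₀
  exact ⟨⟨K, hK, fun K' hK' => hK.unique hAB hA₀ hpqw hf hf_ne hf_A₀ hK'⟩,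
    fun K hK n y hy t => hK.transmutedHeatPoly_eq hAB hA₀ hpqw hf hf_ne hf_A₀ n hy t⟩
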